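/- Let $G=(V,E,w)$ be a finite graph with $n=|V|\ge 3$ vertices and positive rational edge weights, and let $k\ge 2$. A $k$-cut is a set of edges of $G$ whose deletion leaves at least $k$ connected components, and a minimum $k$-cut is a $k$-cut of least total weight. The Karger–Stein random contraction algorithm works as follows: while the current graph has more than $k$ vertices (and at least one edge), sample an edge with probability proportional to its weight, contract its two end points into one vertex (keeping parallel edges), and remove self-loops; when the loop ends, return the set of edges of the original graph whose end points have been contracted into different remaining vertices. Then there is an absolute constant $C>0$ such that for all such $G$ and $k$ and every fixed minimum $k$-cut $F$ of $G$, the algorithm outputs $F$ with probability at least $$n^{-k}\,(k\ln n)^{-C k^2\ln\ln n}.$$ Moreover, for every fixed $k\ge 2$ there is a constant $C_k>0$ such that for all such $G$ and every minimum $k$-cut $F$ of $G$, this probability is at least $n^{-k}\,2^{-C_k(\ln\ln n)^2}$. -/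

import Mathlib

universe u

/-- A weighted graph `G = (V, E, w)` with positive rational edge weights; the values of `weight`
outside the edge set are never used. -/
structure WeightedGraph (V : Type u) where
  /-- the underlying graph `(V, E)` -/
  graph : SimpleGraph V
  /-- the edge weights `w` -/
  weight : Sym2 V → ℚ
  weight_pos : ∀ e ∈ graph.edgeSet, 0 < weight e

namespace WeightedGraph

/-- The weight of a set of edges. -/
def cutWeight {V : Type u} (G : WeightedGraph V) (F : Finset (Sym2 V)) : ℚ :=
  ∑ e ∈ F, G.weight e

/-- A `k`-cut: a set of edges whose deletion leaves at least `k` connected components. -/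
def IsKCut {V : Type u} (G : WeightedGraph V) (k : ℕ) (F : Finset (Sym2 V)) : Prop :=
  (∀ e ∈ F, e ∈ G.graph.edgeSet) ∧
    k ≤ Nat.card (G.graph.deleteEdges (F : Set (Sym2 V))).ConnectedComponent

/-- A minimum `k`-cut: a `k`-cut of least weight. -/
def IsMinKCut {V : Type u} (G : WeightedGraph V) (k : ℕ) (F : Finset (Sym2 V)) : Prop :=
  G.IsKCut k F ∧ ∀ F' : Finset (Sym2 V), G.IsKCut k F' → G.cutWeight F ≤ G.cutWeight F'

/- A contracted graph is represented by the equivalence relation `r` on the original vertices whose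
classes are its vertices. -/

open Classical in
/-- The edges of the contracted graph, as edges of the original graph: those which have not become
self-loops, i.e. whose end points lie in different classes of `r`. -/
noncomputable def liveEdges {V : Type u} [Fintype V] (G : WeightedGraph V) (r : Setoid V) :
    Finset (Sym2 V) :=
  Finset.univ.filter fun e => e ∈ G.graph.edgeSet ∧ ¬ (e.map (Quotient.mk r)).IsDiag

/-- Contract the two end points of `e`: merge their classes. -/
def contract {V : Type u} (r : Setoid V) (e : Sym2 V) : Setoid V :=
  r ⊔ Relation.EqvGen.setoid fun a b => e = s(a, b)

open Classical in
/-- The weight function from which an edge of the contracted graph is sampled. -/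
noncomputable def liveWeight {V : Type u} [Fintype V] (G : WeightedGraph V) (r : Setoid V)
    (e : Sym2 V) : ENNReal :=
  if e ∈ G.liveEdges r then ENNReal.ofReal (G.weight e : ℝ) else 0

theorem tsum_liveWeight_ne_zero {V : Type u} [Fintype V] (G : WeightedGraph V) (r : Setoid V)
    (h : (G.liveEdges r).Nonempty) : ∑' e, G.liveWeight r e ≠ 0 := by
  obtain ⟨e, he⟩ := h
  intro h0
  have h1 := ENNReal.tsum_eq_zero.1 h0 e
  have h2 : e ∈ G.graph.edgeSet := by
    have := he
    simp only [liveEdges, Finset.mem_filter] at this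
    exact this.2.1
  have h3 : (0 : ℝ) < (G.weight e : ℝ) := by exact_mod_cast G.weight_pos e h2
  simp only [liveWeight, if_pos he, ENNReal.ofReal_eq_zero] at h1
  exact absurd h3 (not_lt.2 h1)

theorem tsum_liveWeight_ne_top {V : Type u} [Fintype V] (G : WeightedGraph V) (r : Setoid V) :
    ∑' e, G.liveWeight r e ≠ ⊤ := by
  classical
  rw [tsum_fintype]
  refine (ENNReal.sum_lt_top.2 fun e _ => ?_).ne
  unfold liveWeight
  split_ifs
  · exact ENNReal.ofReal_lt_top
  · exact ENNReal.zero_lt_top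

/-- Sample an edge of the contracted graph with probability proportional to its weight. -/
noncomputable def sampleEdge {V : Type u} [Fintype V] (G : WeightedGraph V) (r : Setoid V)
    (h : (G.liveEdges r).Nonempty) : PMF (Sym2 V) :=
  PMF.normalize (G.liveWeight r) (G.tsum_liveWeight_ne_zero r h) (G.tsum_liveWeight_ne_top r)

open Classical in
/-- One iteration of the loop: while there are more than `k` vertices, sample an edge and contract
it. If no edge is left (which, with more than `k` vertices, only happens when the original graph has
more than `k` connected components), nothing can be sampled and the loop stops. -/
noncomputable def loopStep {V : Type u} [Fintype V] (G : WeightedGraph V) (k : ℕ)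
    (r : Setoid V) : PMF (Setoid V) :=
  if h : k < Nat.card (Quotient r) ∧ (G.liveEdges r).Nonempty then
    (G.sampleEdge r h.2).map (contract r)
  else
    PMF.pure r

/-- The output distribution of the Karger–Stein algorithm: start with all vertices distinct, run
the loop, and return the edges of `G` between the remaining (expanded) vertices. Every contraction
lowers the number of vertices, so the loop has stopped after `|V|` iterations. -/
noncomputable def kargerStein {V : Type u} [Fintype V] (G : WeightedGraph V) (k : ℕ) :
    PMF (Finset (Sym2 V)) :=
  ((fun p : PMF (Setoid V) => p.bind (G.loopStep k))^[Fintype.card V] (PMF.pure ⊥)).map G.liveEdges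

end WeightedGraph

/-! Scale the weights so that the minimum `k`-cut `F` has weight `k`; then every partition of the
vertices into at least `k` classes costs at least `k` (`ColoringBound`), also after contractions. If
`F` is nonempty, the algorithm returns `F` when it never samples an edge of `F`. With `R` vertices
left and live weight `W` outside `F`, a step fails with probability `k / (W + k)`. If all degrees
were at least 2, then `W + k ≥ R` and the success probability would be about `n ^ (-k)`; the
obstruction is vertices of degree below 2.

Such vertices are cuts of weight less than 2 in the original graph, and these are few: at most `n`
times a function of `k` (`card_smallCuts_le`). The bound rests on greedy refinement of colourings
(`exists_saturating_coloring`), on the absence of large sunflowers among small cuts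
(`card_petals_lt`), and on splitting the graph along a balanced small cut.

Moreover small cuts die out quickly. Fewer than `k` vertices have degree below 1, and at most `2k/ε`
carry more than `ε` of the weight of `F`. Every other vertex of degree below 2 is a "tame" cut, with
weight at least `1 - ε` outside `F`, so contractions destroy it at a definite rate. If `A` tame cuts
survive, then `R ≤ W + a + A` with `a = 2k + 2k/ε`, and the potential `Ψ = R - a + A/ε` has weighted
total decrease at least `(1 - 2ε)Ψ` as long as `R ≥ a` (`potential_drift`). By convexity of `x ^
(-κ)` with `κ = k/(1 - 2ε)`, a constant times `Ψ ^ (-κ)` is a lower bound for the success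
probability which is preserved step by step (`le_outputProb`); once `R < a + 2`, the Karger–Stein
bound takes over.

Initially `Ψ` is at most `n` times `33 (ln n) (3k² + 1)^(3k)` for `ε = 1/(4 ln n)`. With this `ε`,
replacing the exponent `k` by `κ` costs at most a factor `e ^ k`, and the remaining factors fit into
the allowed loss (`loss_le`). -/

namespace Multigraph

open Finset

/-! ### Colourings of weighted multigraphs and their greedy refinement. -/

variable {E : Type*} [Fintype E]

open Classical in
/-- The number which is `0` if `p` holds and `x` otherwise. -/
noncomputable def zeroIf (p : Prop) (x : ℝ) : ℝ := if p then 0 else x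

theorem zeroIf_pos {p : Prop} (h : p) (x : ℝ) : zeroIf p x = 0 := if_pos h

theorem zeroIf_neg {p : Prop} (h : ¬ p) (x : ℝ) : zeroIf p x = x := if_neg h

theorem zeroIf_nonneg (p : Prop) {x : ℝ} (hx : 0 ≤ x) : 0 ≤ zeroIf p x := by
  unfold zeroIf; split_ifs <;> simp [hx]

theorem zeroIf_le (p : Prop) {x : ℝ} (hx : 0 ≤ x) : zeroIf p x ≤ x := by
  unfold zeroIf; split_ifs <;> simp [hx]

theorem zeroIf_le_of_imp {p q : Prop} (h : p → q) {x : ℝ} (hx : 0 ≤ x) :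
    zeroIf q x ≤ zeroIf p x := by
  by_cases hp : p
  · rw [zeroIf_pos hp, zeroIf_pos (h hp)]
  · rw [zeroIf_neg hp]
    exact zeroIf_le _ hx

/-- The total weight of the edges of the multigraph `(s, t)` whose ends get different colours. -/
noncomputable def colorCost {V α : Type*} (w : E → ℝ) (s t : E → V) (f : V → α) : ℝ :=
  ∑ e, zeroIf (f (s e) = f (t e)) (w e)

/-- The weight of the edges leaving `S`. -/
noncomputable def cutCost {V : Type*} (w : E → ℝ) (s t : E → V) (S : Finset V) : ℝ :=
  colorCost w s t (fun v => v ∈ S)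

/-- The weight of the edges inside the colour classes of `f` which are separated by `S`. -/
noncomputable def insideCost {V α : Type*} (w : E → ℝ) (s t : E → V) (f : V → α)
    (S : Finset V) : ℝ :=
  ∑ e, zeroIf (f (s e) = f (t e) → (s e ∈ S ↔ t e ∈ S)) (w e)

/-- Every partition of the vertices into at least `k` classes costs at least `k`. -/
def ColoringBound {V : Type*} (w : E → ℝ) (s t : E → V) (k : ℕ) : Prop :=
  ∀ f : V → ℕ, k ≤ (Set.range f).ncard → (k : ℝ) ≤ colorCost w s t f

theorem cutCost_eq {V : Type*} (w : E → ℝ) (s t : E → V) (S : Finset V) :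
    cutCost w s t S = ∑ e, zeroIf (s e ∈ S ↔ t e ∈ S) (w e) := by
  simp only [cutCost, colorCost, eq_iff_iff]

theorem ColoringBound.le_colorCost {V α : Type*} [Finite V] {w : E → ℝ} {s t : E → V} {k : ℕ}
    (h : ColoringBound w s t k) (f : V → α) (hk : k ≤ (Set.range f).ncard) :
    (k : ℝ) ≤ colorCost w s t f := by
  obtain ⟨g, hg⟩ := exists_injective_nat (Set.range f)
  have h1 : (Set.range fun v => g ⟨f v, v, rfl⟩) = Set.range g := by
    ext x
    constructor
    · rintro ⟨v, rfl⟩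
      exact ⟨_, rfl⟩
    · rintro ⟨⟨_, v, rfl⟩, rfl⟩
      exact ⟨v, rfl⟩
  have h2 := h (fun v => g ⟨f v, v, rfl⟩) (by
    rw [h1, ← Set.image_univ, Set.ncard_image_of_injective _ hg, Set.ncard_univ]
    exact hk)
  refine h2.trans_eq (sum_congr rfl fun e _ => ?_)
  by_cases h3 : f (s e) = f (t e)
  · rw [zeroIf_pos h3, zeroIf_pos (hg.eq_iff.2 (Subtype.ext h3))]
  · rw [zeroIf_neg h3, zeroIf_neg fun h4 => h3 (congrArg Subtype.val (hg h4))]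

theorem ColoringBound.contract {V V' : Type*} {w : E → ℝ} {s t : E → V} {k : ℕ}
    (h : ColoringBound w s t k) {φ : V → V'} (hφ : Function.Surjective φ) :
    ColoringBound w (φ ∘ s) (φ ∘ t) k := by
  intro f hf
  exact h (f ∘ φ) (by rwa [hφ.range_comp])

/-- Splitting a class along a set of inside cost less than 1 adds one colour for a cost below 1, so
the cost stays below the number of colours. `ColoringBound` forbids this at `k` colours, so the
refinement gets stuck earlier, and then no such set splits a class. -/
theorem exists_saturating_coloring {V : Type*} [Finite V] {w : E → ℝ} (hw : ∀ e, 0 ≤ w e)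
    {s t : E → V} {k : ℕ} (h : ColoringBound w s t k) (f₀ : V → ℕ)
    (h₀ : colorCost w s t f₀ < (Set.range f₀).ncard) (hk : (Set.range f₀).ncard ≤ k) :
    ∃ f : V → ℕ, (∀ u v, f u = f v → f₀ u = f₀ v) ∧ (Set.range f).ncard < k ∧
      ∀ S : Finset V, insideCost w s t f₀ S < 1 → ∀ u v, f u = f v → (u ∈ S ↔ v ∈ S) := by
  classical
  -- The induction is on a bound `d` for the number of colours missing from `k`.
  suffices key : ∀ (d : ℕ) (f : V → ℕ), k ≤ (Set.range f).ncard + d →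
      colorCost w s t f < (Set.range f).ncard → (Set.range f).ncard ≤ k →
      (∀ u v, f u = f v → f₀ u = f₀ v) →
      ∃ f : V → ℕ, (∀ u v, f u = f v → f₀ u = f₀ v) ∧ (Set.range f).ncard < k ∧
      ∀ S : Finset V, insideCost w s t f₀ S < 1 → ∀ u v, f u = f v → (u ∈ S ↔ v ∈ S) from
    key k f₀ (by omega) h₀ hk fun _ _ h => h
  intro d
  induction d with
  | zero =>
    intro f h1 h2 h3 _
    have h4 := h f h1
    have h5 : ((Set.range f).ncard : ℝ) ≤ k := by exact_mod_cast h3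
    linarith
  | succ d ih =>
    intro f h1 h2 h3 href
    have hlt : (Set.range f).ncard < k := by
      rcases h3.lt_or_eq with h4 | h4
      · exact h4
      · have h5 := h f h4.ge
        rw [h4] at h2
        linarith
    by_cases hall : ∀ S : Finset V, insideCost w s t f₀ S < 1 →
        ∀ u v, f u = f v → (u ∈ S ↔ v ∈ S)
    · exact ⟨f, href, hlt, hall⟩
    · push Not at hall
      obtain ⟨S, hS, a, b, hab, hne⟩ := hall
      obtain ⟨u, v, huv, hu, hv⟩ : ∃ u v, f u = f v ∧ u ∈ S ∧ v ∉ S := by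
        rcases hne with ⟨h1, h2⟩ | ⟨h1, h2⟩
        · exact ⟨a, b, hab, h1, h2⟩
        · exact ⟨b, a, hab.symm, h2, h1⟩
      obtain ⟨N, hN⟩ := (Set.finite_range f).exists_notMem
      have hN' : ∀ x, f x ≠ N := fun x hx => hN ⟨x, hx⟩
      set f' : V → ℕ := fun x => if f x = f u ∧ x ∈ S then N else f x with hf'
      have hr : Set.range f' = insert N (Set.range f) := by
        ext y
        simp only [Set.mem_range, Set.mem_insert_iff]
        constructor
        · rintro ⟨x, rfl⟩
          by_cases hx : f x = f u ∧ x ∈ S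
          · left; simp [hf', hx]
          · right; exact ⟨x, by simp only [hf', if_neg hx]⟩
        · rintro (rfl | ⟨x, rfl⟩)
          · exact ⟨u, by simp [hf', hu]⟩
          · by_cases hx : f x = f u
            · exact ⟨v, by simp [hf', hv, hx, huv]⟩
            · exact ⟨x, by simp [hf', hx]⟩
      have hcard : (Set.range f').ncard = (Set.range f).ncard + 1 := by
        rw [hr, Set.ncard_insert_of_notMem hN]
      -- A newly bichromatic edge lies inside a class of `f`, hence of `f₀`, and is separated by
      -- `S`.
      have hcost : colorCost w s t f' ≤ colorCost w s t f + insideCost w s t f₀ S := by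
        unfold colorCost insideCost
        rw [← sum_add_distrib]
        refine sum_le_sum fun e _ => ?_
        have hwe := hw e
        by_cases h5 : f (s e) = f (t e)
        · by_cases h7 : (s e ∈ S ↔ t e ∈ S)
          · have : f' (s e) = f' (t e) := by simp [hf', h5, h7]
            rw [zeroIf_pos this]
            exact add_nonneg (zeroIf_nonneg _ hwe) (zeroIf_nonneg _ hwe)
          · rw [zeroIf_pos h5, zero_add, zeroIf_neg (p := _ → _) fun h8 => h7 (h8 (href _ _ h5))]
            exact zeroIf_le _ hwe
        · rw [zeroIf_neg h5]
          exact (zeroIf_le _ hwe).trans (le_add_of_nonneg_right (zeroIf_nonneg _ hwe))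
      refine ih f' (by omega) ?_ (by omega) ?_
      · rw [hcard]; push_cast; linarith
      · intro x y hxy
        apply href
        simp only [hf'] at hxy
        split_ifs at hxy with h5 h6 h6
        · rw [h5.1, h6.1]
        · exact absurd hxy.symm (hN' _)
        · exact absurd hxy (hN' _)
        · exact hxy

/-! ### Sunflowers of small cuts and branching. -/

theorem two_mul_le_sum_zeroIf {x : ℝ} (hx : 0 ≤ x) {p q r : Prop} (h₁ : ¬ (p ∧ q))
    (h₂ : ¬ (p ∧ r)) (h₃ : ¬ (q ∧ r)) : 2 * x ≤ zeroIf p x + zeroIf q x + zeroIf r x := by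
  unfold zeroIf
  by_cases hp : p <;> by_cases hq : q <;> by_cases hr : r <;> simp_all <;> linarith

open Classical in
/-- There is no sunflower of `k` small cuts whose core is a cut of weight at least one. -/
theorem card_petals_lt {V : Type*} [Finite V] {w : E → ℝ} (hw : ∀ e, 0 ≤ w e)
    {s t : E → V} {k : ℕ} (h : ColoringBound w s t k) (hk : 2 ≤ k) (Y : Finset V)
    (hYne : Y.Nonempty) (hY : 1 ≤ cutCost w s t Y) (𝒢 : Finset (Finset V))
    (hsub : ∀ S ∈ 𝒢, Y ⊂ S) (hcut : ∀ S ∈ 𝒢, cutCost w s t S < 2)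
    (hdisj : ∀ S ∈ 𝒢, ∀ S' ∈ 𝒢, S ≠ S' → S ∩ S' = Y) : 𝒢.card < k := by
  by_contra! hcard
  obtain ⟨y, hy⟩ := hYne
  have hpet : ∀ S ∈ 𝒢, ∃ x ∈ S, x ∉ Y := fun S hS => Finset.exists_of_ssubset (hsub S hS)
  have hmem : ∀ S ∈ 𝒢, ∀ S' ∈ 𝒢, S ≠ S' → ∀ x ∈ S, x ∈ S' → x ∈ Y := by
    intro S hS S' hS' hne x hx hx'
    rw [← hdisj S hS S' hS' hne]
    exact mem_inter.2 ⟨hx, hx'⟩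
  -- The general count uses the weight of `Y` with coefficient `k - 4`, so `k = 2` and `k = 3` need
  -- their own arguments.
  rcases (by omega : k = 2 ∨ k = 3 ∨ 4 ≤ k) with rfl | rfl | hk4
  · obtain ⟨S, hS, S', hS', hne⟩ := Finset.one_lt_card.1 (by omega : 1 < 𝒢.card)
    obtain ⟨x, hx, hxY⟩ := hpet S' hS'
    have hxS : x ∉ S := fun h5 => hxY (hmem S hS S' hS' hne x h5 hx)
    have h5 := h.le_colorCost (fun v => v ∈ S) (by
      rw [← Set.ncard_pair (show (True : Prop) ≠ False by simp)]
      refine Set.ncard_le_ncard ?_ (Set.finite_range _)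
      rintro z (rfl | rfl)
      · exact ⟨y, by simpa using (hsub S hS).1 hy⟩
      · exact ⟨x, by simpa using hxS⟩)
    have := hcut S hS
    unfold cutCost at this
    push_cast at h5
    linarith
  · obtain ⟨S₁, S₂, S₃, h1, h2, h3, h12, h13, h23⟩ := Finset.two_lt_card_iff.1 (by omega : 2 < 𝒢.card)
    have key : ∀ S ∈ 𝒢, ∀ S' ∈ 𝒢, S ≠ S' →
        3 ≤ colorCost w s t (fun v => (v ∈ Y, v ∈ S)) := by
      intro S hS S' hS' hne
      obtain ⟨x, hx, hxY⟩ := hpet S hS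
      obtain ⟨x', hx', hxY'⟩ := hpet S' hS'
      have hxS : x' ∉ S := fun h5 => hxY' (hmem S hS S' hS' hne x' h5 hx')
      refine le_trans (by norm_num) (h.le_colorCost _ (?_ : 3 ≤ _))
      have h6 : ({(True, True), (False, True), (False, False)} : Set (Prop × Prop)).ncard = 3 := by
        rw [Set.ncard_eq_three]
        exact ⟨_, _, _, by simp, by simp, by simp, rfl⟩
      rw [← h6]
      refine Set.ncard_le_ncard ?_ (Set.finite_range _)
      rintro z (rfl | rfl | rfl)
      · exact ⟨y, by simp [hy, (hsub S hS).1 hy]⟩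
      · exact ⟨x, by simp [hx, hxY]⟩
      · exact ⟨x', by simp [hxS, hxY']⟩
    -- An edge leaving `Y` ends in at most one petal, so at least two of the three cuts contain it.
    -- This pays for its appearance in both colourings, each of which costs at least 3, while the
    -- three cuts together weigh less than 6.
    have hle : colorCost w s t (fun v => (v ∈ Y, v ∈ S₂)) + colorCost w s t (fun v => (v ∈ Y, v ∈ S₃))
        ≤ cutCost w s t S₁ + cutCost w s t S₂ + cutCost w s t S₃ := by
      rw [cutCost_eq, cutCost_eq, cutCost_eq]
      unfold colorCost
      rw [← sum_add_distrib, ← sum_add_distrib, ← sum_add_distrib]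
      refine sum_le_sum fun e _ => ?_
      have hwe := hw e
      have hin : ∀ v ∈ Y, v ∈ S₁ ∧ v ∈ S₂ ∧ v ∈ S₃ := fun v hv =>
        ⟨(hsub _ h1).1 hv, (hsub _ h2).1 hv, (hsub _ h3).1 hv⟩
      have hout : ∀ v ∉ Y, ¬ (v ∈ S₁ ∧ v ∈ S₂) ∧ ¬ (v ∈ S₁ ∧ v ∈ S₃) ∧ ¬ (v ∈ S₂ ∧ v ∈ S₃) :=
        fun v hv => ⟨fun h => hv (hmem _ h1 _ h2 h12 v h.1 h.2),
          fun h => hv (hmem _ h1 _ h3 h13 v h.1 h.2), fun h => hv (hmem _ h2 _ h3 h23 v h.1 h.2)⟩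
      have hsep : ∀ a b, a ∈ Y → b ∉ Y → 2 * w e ≤ zeroIf (a ∈ S₁ ↔ b ∈ S₁) (w e) +
          zeroIf (a ∈ S₂ ↔ b ∈ S₂) (w e) + zeroIf (a ∈ S₃ ↔ b ∈ S₃) (w e) := by
        intro a b ha hb
        simp only [(hin a ha).1, (hin a ha).2.1, (hin a ha).2.2, true_iff]
        exact two_mul_le_sum_zeroIf hwe (hout b hb).1 (hout b hb).2.1 (hout b hb).2.2
      by_cases c0 : (s e ∈ Y ↔ t e ∈ Y)
      · have hpair : ∀ S : Finset V,
            zeroIf (((s e ∈ Y, s e ∈ S) : Prop × Prop) = (t e ∈ Y, t e ∈ S)) (w e) ≤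
              zeroIf (s e ∈ S ↔ t e ∈ S) (w e) := fun S =>
          zeroIf_le_of_imp (fun h5 => by simp [c0, h5]) hwe
        have := zeroIf_nonneg (s e ∈ S₁ ↔ t e ∈ S₁) hwe
        linarith [hpair S₂, hpair S₃]
      · rw [zeroIf_neg fun h5 => c0 (iff_of_eq (Prod.mk.inj h5).1),
          zeroIf_neg fun h5 => c0 (iff_of_eq (Prod.mk.inj h5).1)]
        by_cases c1 : s e ∈ Y
        · have := hsep (s e) (t e) c1 fun h' => c0 ⟨fun _ => h', fun _ => c1⟩
          linarith
        · have := hsep (t e) (s e)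
            (by_contra fun h' => c0 ⟨fun h'' => absurd h'' c1, fun h'' => absurd h'' h'⟩) c1
          simp only [iff_comm (a := t e ∈ _)] at this
          linarith
    have := key S₂ h2 S₁ h1 h12.symm
    have := key S₃ h3 S₁ h1 h13.symm
    have := hcut _ h1
    have := hcut _ h2
    have := hcut _ h3
    linarith
  -- Use `k - 2` petals: with the core and the outside they give `k` classes. A further petal
  -- ensures that the outside is nonempty.
  · obtain ⟨𝒢', hsub', hcard'⟩ := Finset.exists_subset_card_eq (show k - 2 ≤ 𝒢.card by omega)
    obtain ⟨S', hS', hS'n⟩ : ∃ S' ∈ 𝒢, S' ∉ 𝒢' := by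
      by_contra! hcon
      have := Finset.card_le_card (show 𝒢 ⊆ 𝒢' from hcon)
      omega
    obtain ⟨x', hx', hxY'⟩ := hpet S' hS'
    set f : V → Finset (Finset V) := fun v => 𝒢'.filter (v ∈ ·) with hf
    have f1 : ∀ v ∈ Y, f v = 𝒢' := fun v hv =>
      Finset.filter_true_of_mem fun S hS => (hsub S (hsub' hS)).1 hv
    have f2 : ∀ v, v ∉ Y → (f v).card ≤ 1 := by
      intro v hv
      rw [Finset.card_le_one]
      intro A hA B hB
      simp only [hf, mem_filter] at hA hB
      by_contra hne
      exact hv (hmem A (hsub' hA.1) B (hsub' hB.1) hne v hA.2 hB.2)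
    have hrange : k ≤ (Set.range f).ncard := by
      have h6 : (insert 𝒢' (insert ∅ (𝒢'.image fun S => ({S} : Finset (Finset V))))).card = k := by
        rw [card_insert_of_notMem, card_insert_of_notMem, card_image_of_injective _
          Finset.singleton_injective]
        · omega
        · simp
        · simp only [mem_insert, mem_image, not_or]
          constructor
          · rintro rfl; simp at hcard'; omega
          · rintro ⟨S, -, hS⟩
            have := congrArg Finset.card hS
            simp at this; omega
      rw [← h6, ← Set.ncard_coe_finset]
      refine Set.ncard_le_ncard ?_ (Set.finite_range _)
      intro z hz
      simp only [coe_insert, coe_image, Set.mem_insert_iff, Set.mem_image, mem_coe] at hz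
      rcases hz with rfl | rfl | ⟨S, hS, rfl⟩
      · exact ⟨y, f1 y hy⟩
      · refine ⟨x', Finset.filter_false_of_mem fun S hS hx => ?_⟩
        exact hxY' (hmem S (hsub' hS) S' hS' (fun h => hS'n (h ▸ hS)) x' hx hx')
      · obtain ⟨x, hx, hxY⟩ := hpet S (hsub' hS)
        refine ⟨x, ?_⟩
        exact (Finset.eq_of_subset_of_card_le
          (Finset.singleton_subset_iff.2 (mem_filter.2 ⟨hS, hx⟩))
            (by simpa using f2 x hxY)).symm
    have hcost := h.le_colorCost f hrange
    -- An edge leaving `Y` lies in at least `k - 3` of the cuts, which is one for the colouring and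
    -- `k - 4` for the cut of `Y`. As that cut weighs at least 1, the left side is at least `2k -
    -- 4`, while the right side is less than `2(k - 2)`.
    have hkey : colorCost w s t f + ((k : ℝ) - 4) * cutCost w s t Y ≤
        ∑ S ∈ 𝒢', cutCost w s t S := by
      simp only [cutCost_eq]
      unfold colorCost
      rw [sum_comm, mul_sum, ← sum_add_distrib]
      refine sum_le_sum fun e _ => ?_
      have hwe := hw e
      have hsum : (∑ S ∈ 𝒢', zeroIf (s e ∈ S ↔ t e ∈ S) (w e)) =
          ((𝒢'.filter fun S => ¬ (s e ∈ S ↔ t e ∈ S)).card : ℝ) * w e := by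
        rw [← nsmul_eq_mul, ← Finset.sum_const, Finset.sum_filter]
        refine sum_congr rfl fun S _ => ?_
        by_cases h7 : (s e ∈ S ↔ t e ∈ S) <;> simp [h7, zeroIf]
      rw [hsum]
      have hsep : ∀ a b : V, a ∈ Y → b ∉ Y →
          k - 3 ≤ (𝒢'.filter fun S => ¬ (a ∈ S ↔ b ∈ S)).card := by
        intro a b ha hb
        have h8 := Finset.card_filter_add_card_filter_not (s := 𝒢') (b ∈ ·)
        have h9 := f2 b hb
        have h10 : (𝒢'.filter fun S => ¬ (a ∈ S ↔ b ∈ S)) = 𝒢'.filter (fun S => ¬ b ∈ S) := by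
          refine Finset.filter_congr fun S hS => ?_
          simp [(hsub S (hsub' hS)).1 ha]
        rw [h10]
        simp only [hf] at h9
        omega
      by_cases c1 : (s e ∈ Y ↔ t e ∈ Y)
      · rw [zeroIf_pos c1]
        by_cases c2 : f (s e) = f (t e)
        · rw [zeroIf_pos c2]
          simp only [mul_zero, add_zero]
          positivity
        · rw [zeroIf_neg c2]
          have : (𝒢'.filter fun S => ¬ (s e ∈ S ↔ t e ∈ S)).Nonempty := by
            by_contra hcon
            rw [Finset.not_nonempty_iff_eq_empty, Finset.filter_eq_empty_iff] at hcon
            refine c2 (Finset.filter_congr fun S hS => ?_)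
            simpa using hcon hS
          have h8 : (1:ℝ) ≤ (𝒢'.filter fun S => ¬ (s e ∈ S ↔ t e ∈ S)).card := by
            exact_mod_cast this.card_pos
          nlinarith
      · have h8 : ((k - 3 : ℕ) : ℝ) ≤ (𝒢'.filter fun S => ¬ (s e ∈ S ↔ t e ∈ S)).card := by
          norm_cast
          by_cases c3 : s e ∈ Y
          · exact hsep _ _ c3 fun h => c1 (by simp [c3, h])
          · have c4 : t e ∈ Y :=
              by_contra fun h' => c1 ⟨fun h'' => absurd h'' c3, fun h'' => absurd h'' h'⟩
            have := hsep _ _ c4 c3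
            simpa only [iff_comm] using this
        rw [Nat.cast_sub (by omega)] at h8
        rw [zeroIf_neg c1]
        push_cast at h8
        have h9 := zeroIf_le (f (s e) = f (t e)) hwe
        nlinarith
    have hlt : ∑ S ∈ 𝒢', cutCost w s t S < ∑ S ∈ 𝒢', (2:ℝ) := by
      refine Finset.sum_lt_sum_of_nonempty (Finset.card_pos.1 (by omega)) fun S hS => hcut S (hsub' hS)
    rw [sum_const, hcard', nsmul_eq_mul, Nat.cast_sub (by omega)] at hlt
    have hk4' : (4:ℝ) ≤ k := by exact_mod_cast hk4
    push_cast at hlt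
    nlinarith

open Classical in
/-- Counting the members of a family above `Y` when the proper supersets of every set can be hit
by few elements. -/
theorem card_filter_superset_le {V : Type*} (𝓑 : Finset (Finset V)) (h : ℕ)
    (p : Finset V → Prop) (hp : ∀ Y x, p Y → p (insert x Y))
    (hit : ∀ Y, p Y → ∃ H : Finset V, H.card ≤ h ∧ ∀ S ∈ 𝓑, Y ⊂ S → ∃ x ∈ H, x ∈ S ∧ x ∉ Y)
    (j : ℕ) (Y : Finset V) (hY : p Y) :
    (𝓑.filter fun S => Y ⊆ S ∧ S.card ≤ Y.card + j).card ≤ (h + 1) ^ j := by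
  induction j generalizing Y with
  | zero =>
    rw [pow_zero, Finset.card_le_one]
    have : ∀ S ∈ 𝓑.filter fun S => Y ⊆ S ∧ S.card ≤ Y.card + 0, Y = S := by
      intro S hS
      simp only [mem_filter] at hS
      exact Finset.eq_of_subset_of_card_le hS.2.1 hS.2.2
    intro A hA B hB
    rw [← this A hA, ← this B hB]
  | succ j ih =>
    obtain ⟨H, hH, hhit⟩ := hit Y hY
    -- Branch on the element of the hitting set: a proper superset of `Y` lies above `insert x Y`
    -- for one of at most `h` choices of `x`, and one fewer element remains to be added.
    have hsub : (𝓑.filter fun S => Y ⊆ S ∧ S.card ≤ Y.card + (j + 1)) ⊆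
        insert Y ((H \ Y).biUnion fun x =>
          𝓑.filter fun S => insert x Y ⊆ S ∧ S.card ≤ (insert x Y).card + j) := by
      intro S hS
      simp only [mem_filter] at hS
      rw [mem_insert, mem_biUnion]
      by_cases hE : S = Y
      · exact Or.inl hE
      · obtain ⟨x, hxH, hxS, hxY⟩ := hhit S hS.1 (Finset.ssubset_iff_subset_ne.2
          ⟨hS.2.1, Ne.symm hE⟩)
        refine Or.inr ⟨x, mem_sdiff.2 ⟨hxH, hxY⟩, ?_⟩
        rw [mem_filter, card_insert_of_notMem hxY]
        exact ⟨hS.1, Finset.insert_subset hxS hS.2.1, by omega⟩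
    calc _ ≤ _ := Finset.card_le_card hsub
      _ ≤ _ := Finset.card_insert_le _ _
      _ ≤ (∑ x ∈ H \ Y, (h + 1) ^ j) + 1 := by
          gcongr
          exact Finset.card_biUnion_le.trans (Finset.sum_le_sum fun x _ => ih _ (hp _ _ hY))
      _ ≤ h * (h + 1) ^ j + (h + 1) ^ j := by
          rw [sum_const, smul_eq_mul]
          gcongr
          · exact (Finset.card_le_card Finset.sdiff_subset).trans hH
          · exact Nat.one_le_pow _ _ (by omega)
      _ = (h + 1) ^ (j + 1) := by ring

end Multigraph

/-! ### The number of small cuts is linear in the number of vertices. -/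

namespace Multigraph

open Finset

variable {E : Type*} [Fintype E]

theorem cutCost_compl {V : Type*} [Fintype V] [DecidableEq V] (w : E → ℝ) (s t : E → V)
    (S : Finset V) : cutCost w s t Sᶜ = cutCost w s t S := by
  simp only [cutCost_eq, mem_compl, not_iff_not]

open Classical in
/-- The vertex sets left by edges of total weight less than two. -/
noncomputable def smallCuts {V : Type*} [Fintype V] (w : E → ℝ) (s t : E → V) :
    Finset (Finset V) :=
  univ.filter fun S => cutCost w s t S < 2

theorem mem_smallCuts {V : Type*} [Fintype V] {w : E → ℝ} {s t : E → V} {S : Finset V} :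
    S ∈ smallCuts w s t ↔ cutCost w s t S < 2 := by
  simp [smallCuts]

open Classical in
-- A set which splits no fibre of `φ` is determined by its image and keeps its cut weight when the
-- fibres are contracted.
theorem card_saturated_smallCuts_le {V V' : Type*} [Fintype V] [Fintype V'] (w : E → ℝ)
    (s t : E → V) (φ : V → V') (𝓐 : Finset (Finset V))
    (h𝓐 : ∀ S ∈ 𝓐, S ∈ smallCuts w s t ∧ ∀ u v, φ u = φ v → (u ∈ S ↔ v ∈ S)) :
    𝓐.card ≤ (smallCuts w (φ ∘ s) (φ ∘ t)).card := by
  have key : ∀ S : Finset V, (∀ u v, φ u = φ v → (u ∈ S ↔ v ∈ S)) →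
      ∀ v, φ v ∈ S.image φ ↔ v ∈ S := by
    intro S hS v
    rw [mem_image]
    constructor
    · rintro ⟨u, hu, huv⟩
      exact (hS u v huv).1 hu
    · exact fun hv => ⟨v, hv, rfl⟩
  refine Finset.card_le_card_of_injOn (fun S => S.image φ) ?_ ?_
  · intro S hS
    replace hS := h𝓐 S hS
    simp only [mem_coe, mem_smallCuts] at hS ⊢
    refine lt_of_eq_of_lt ?_ hS.1
    simp only [cutCost_eq, Function.comp, key S hS.2]
  · intro S hS S' hS' h
    ext v
    rw [← key S (h𝓐 S hS).2, ← key S' (h𝓐 S' hS').2]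
    exact iff_of_eq (congrArg (φ v ∈ ·) h)

theorem insideCost_const {V : Type*} (w : E → ℝ) (s t : E → V) (c : ℕ) (S : Finset V) :
    insideCost w s t (fun _ => c) S = cutCost w s t S := by
  simp only [insideCost, cutCost_eq, true_imp_iff]

open Classical in
-- Branch by adding elements. For sets containing a vertex outside `Z`, the elements to try are
-- supplied by a maximal sunflower; the sets inside `Z` are handled directly since `Z` is small.
theorem card_bounded_smallCuts_le {V : Type*} [Fintype V] {w : E → ℝ} (hw : ∀ e, 0 ≤ w e)
    {s t : E → V} {k : ℕ} (h : ColoringBound w s t k) (hk : 2 ≤ k) (r : ℕ) :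
    ((smallCuts w s t).filter fun S => S.card < r).card ≤
      (Fintype.card V + 1) * (k * r + 1) ^ r := by
  rcases isEmpty_or_nonempty V with hV | hV
  · rcases Nat.eq_zero_or_pos r with rfl | hr
    · simp
    calc _ ≤ (univ : Finset (Finset V)).card := Finset.card_le_card (Finset.subset_univ _)
      _ = 1 := by simp
      _ ≤ _ := Nat.one_le_iff_ne_zero.2 (by positivity)
  have hr1 : (Set.range fun _ : V => 0).ncard = 1 := by simp
  obtain ⟨f, -, hfk, hf⟩ := exists_saturating_coloring hw h (fun _ => 0)
    (by rw [hr1]; simp [colorCost, zeroIf]) (by rw [hr1]; omega)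
  simp only [insideCost_const] at hf
  -- Sets of cut weight below 1 are unions of classes of `f`. The vertices in classes of size below
  -- `r` are the only ones which such a set of size below `r` can contain.
  set Z : Finset V := univ.filter fun v => (univ.filter fun u => f u = f v).card < r with hZ
  have hZcard : Z.card ≤ k * r := by
    have h1 := Finset.card_le_mul_card_image (f := f) Z r (by
      intro a ha
      obtain ⟨v, hv, rfl⟩ := mem_image.1 ha
      rw [hZ, mem_filter] at hv
      exact (Finset.card_le_card (Finset.filter_subset_filter _ (Finset.subset_univ _))).trans
        hv.2.le)
    have h2 : (Z.image f).card ≤ k := by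
      refine le_trans ?_ hfk.le
      rw [← Set.ncard_coe_finset]
      refine Set.ncard_le_ncard ?_ (Set.finite_range _)
      rw [coe_image]
      exact Set.image_subset_range _ _
    calc _ ≤ _ := h1
      _ ≤ r * k := Nat.mul_le_mul_left _ h2
      _ = k * r := mul_comm _ _
  set 𝓑 := (smallCuts w s t).filter fun S => S.card < r with h𝓑
  have hB : ∀ S, S ∈ 𝓑 ↔ cutCost w s t S < 2 ∧ S.card < r := fun S => by
    rw [h𝓑, mem_filter, mem_smallCuts]
  have hin : (𝓑.filter fun S => S ⊆ Z).card ≤ (k * r + 1) ^ r := by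
    refine le_trans (Finset.card_le_card ?_) (card_filter_superset_le
      (𝓑.filter fun S => S ⊆ Z) (k * r) (fun _ => True) (fun _ _ _ => trivial) ?_ r ∅ trivial)
    · intro S hS
      have := ((hB S).1 (mem_filter.1 hS).1).2
      rw [mem_filter]
      exact ⟨hS, Finset.empty_subset _, by simp; omega⟩
    · intro Y _
      refine ⟨Z, hZcard, fun S hS hYS => ?_⟩
      obtain ⟨x, hx, hxY⟩ := Finset.exists_of_ssubset hYS
      exact ⟨x, (mem_filter.1 hS).2 hx, hx, hxY⟩
  have hout : ∀ u, u ∉ Z → (𝓑.filter fun S => u ∈ S).card ≤ (k * r + 1) ^ r := by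
    intro u hu
    refine le_trans (Finset.card_le_card ?_) (card_filter_superset_le
      𝓑 (k * r) (fun Y => u ∈ Y) (fun _ _ h => mem_insert_of_mem h) ?_ r {u} (mem_singleton_self u))
    · intro S hS
      rw [mem_filter] at hS ⊢
      have := ((hB S).1 hS.1).2
      exact ⟨hS.1, Finset.singleton_subset_iff.2 hS.2, by omega⟩
    · intro Y huY
      by_cases hex : ∃ S ∈ 𝓑, Y ⊂ S
      · obtain ⟨S₀, hS₀, hYS₀⟩ := hex
        have hYr : Y.card < r := (Finset.card_lt_card hYS₀).trans ((hB _).1 hS₀).2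
        have hY1 : 1 ≤ cutCost w s t Y := by
          by_contra! hlt
          refine hu ?_
          rw [hZ, mem_filter]
          refine ⟨mem_univ _, lt_of_le_of_lt (Finset.card_le_card fun v hv => ?_) hYr⟩
          exact (hf Y hlt v u (mem_filter.1 hv).2).2 huY
        -- A maximal sunflower with core `Y` has fewer than `k` petals; by maximality the union of
        -- its petals meets every larger member of the family outside `Y`.
        obtain ⟨𝒢, h𝒢, hmax⟩ := Finset.exists_max_image
          ((𝓑.filter fun S => Y ⊂ S).powerset.filter
            fun 𝒢 => ∀ S ∈ 𝒢, ∀ S' ∈ 𝒢, S ≠ S' → S ∩ S' = Y) Finset.card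
          ⟨∅, by simp⟩
        rw [mem_filter, mem_powerset] at h𝒢
        have h1 : ∀ S ∈ 𝒢, S ∈ 𝓑 ∧ Y ⊂ S := fun S hS => mem_filter.1 (h𝒢.1 hS)
        have h2 := card_petals_lt hw h hk Y ⟨u, huY⟩ hY1 𝒢 (fun S hS => (h1 S hS).2)
          (fun S hS => ((hB S).1 (h1 S hS).1).1) h𝒢.2
        refine ⟨𝒢.biUnion fun S => S \ Y, ?_, ?_⟩
        · calc _ ≤ ∑ S ∈ 𝒢, (S \ Y).card := Finset.card_biUnion_le
            _ ≤ ∑ S ∈ 𝒢, r := Finset.sum_le_sum fun S hS =>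
                (Finset.card_le_card Finset.sdiff_subset).trans ((hB S).1 (h1 S hS).1).2.le
            _ = 𝒢.card * r := by rw [sum_const, smul_eq_mul]
            _ ≤ k * r := Nat.mul_le_mul_right _ h2.le
        · intro S hS hYS
          by_contra! hcon
          have hnot : ∀ S' ∈ 𝒢, S ∩ S' = Y := by
            intro S' hS'
            refine Finset.Subset.antisymm (fun x hx => ?_)
              (Finset.subset_inter hYS.1 (h1 S' hS').2.1)
            by_contra hxY
            rw [mem_inter] at hx
            exact hxY (hcon x (mem_biUnion.2 ⟨S', hS', mem_sdiff.2 ⟨hx.2, hxY⟩⟩) hx.1)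
          have hSn : S ∉ 𝒢 := fun hS' => by
            have := hnot S hS'
            rw [Finset.inter_self] at this
            exact hYS.ne this.symm
          have := hmax (insert S 𝒢) (by
            rw [mem_filter, mem_powerset]
            refine ⟨Finset.insert_subset (mem_filter.2 ⟨hS, hYS⟩) h𝒢.1, ?_⟩
            intro A hA B hB' hAB
            rw [mem_insert] at hA hB'
            rcases hA with rfl | hA <;> rcases hB' with rfl | hB'
            · exact absurd rfl hAB
            · exact hnot B hB'
            · rw [Finset.inter_comm]; exact hnot A hA
            · exact h𝒢.2 A hA B hB' hAB)
          rw [card_insert_of_notMem hSn] at this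
          omega
      · push Not at hex
        exact ⟨∅, by simp, fun S hS hYS => absurd hYS (hex S hS)⟩
  calc 𝓑.card ≤ ((𝓑.filter fun S => S ⊆ Z) ∪
        (univ \ Z).biUnion fun u => 𝓑.filter fun S => u ∈ S).card := by
        refine Finset.card_le_card fun S hS => ?_
        rw [mem_union, mem_biUnion]
        by_cases hSZ : S ⊆ Z
        · exact Or.inl (mem_filter.2 ⟨hS, hSZ⟩)
        · obtain ⟨u, hu, huZ⟩ := Finset.not_subset.1 hSZ
          exact Or.inr ⟨u, by simp [huZ], mem_filter.2 ⟨hS, hu⟩⟩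
    _ ≤ _ := Finset.card_union_le _ _
    _ ≤ (k * r + 1) ^ r + ∑ u ∈ univ \ Z, (k * r + 1) ^ r := by
        refine add_le_add hin (Finset.card_biUnion_le.trans (Finset.sum_le_sum fun u hu => ?_))
        exact hout u (by simpa using hu)
    _ ≤ (k * r + 1) ^ r + Fintype.card V * (k * r + 1) ^ r := by
        rw [sum_const, smul_eq_mul]
        gcongr
        exact Finset.card_le_univ _
    _ = _ := by ring

open Classical in
-- If some small cut `T` has two large sides, every small cut is a union of few given classes on one
-- of the sides, and contracting these classes reduces to two smaller graphs. Otherwise every small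
-- cut has a side with fewer than `3k` vertices. The term `- 2k` in the bound makes it superadditive
-- enough to absorb the `k` extra vertices of each part.
theorem card_smallCuts_le_aux {w : E → ℝ} (hw : ∀ e, 0 ≤ w e) {k : ℕ} (hk : 2 ≤ k) (n : ℕ) :
    ∀ (V : Type u) [Fintype V] (s t : E → V), Fintype.card V = n → ColoringBound w s t k →
      (smallCuts w s t).card ≤
        4 * (k * (3 * k) + 1) ^ (3 * k) * (max n (4 * k) - 2 * k) := by
  induction n using Nat.strong_induction_on with
  | _ n ih =>
  intro V _ s t hn h
  set D := (k * (3 * k) + 1) ^ (3 * k) with hD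
  rcases lt_or_ge n (6 * k) with hsmall | hlarge
  · calc (smallCuts w s t).card ≤ (univ : Finset (Finset V)).card :=
          Finset.card_le_card (Finset.subset_univ _)
      _ = 2 ^ n := by rw [Finset.card_univ, Fintype.card_finset, hn]
      _ ≤ 2 ^ (6 * k) := Nat.pow_le_pow_right (by norm_num) hsmall.le
      _ = (2 ^ 2) ^ (3 * k) := by rw [← pow_mul]; congr 1; ring
      _ ≤ D := Nat.pow_le_pow_left (by nlinarith) _
      _ ≤ D * (4 * (max n (4 * k) - 2 * k)) := Nat.le_mul_of_pos_right _ (by omega)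
      _ = _ := by ring
  · by_cases hT : ∃ T ∈ smallCuts w s t, 3 * k ≤ T.card ∧ 3 * k ≤ Tᶜ.card
    · obtain ⟨T, hTc, hT1, hT2⟩ := hT
      rw [mem_smallCuts] at hTc
      have hTsum : T.card + Tᶜ.card = n := by rw [Finset.card_add_card_compl, hn]
      set f₀ : V → ℕ := fun v => if v ∈ T then 1 else 0 with hf₀
      have hf₀eq : ∀ u v, f₀ u = f₀ v ↔ (u ∈ T ↔ v ∈ T) := by
        intro u v
        by_cases hu : u ∈ T <;> by_cases hv : v ∈ T <;> simp [hf₀, hu, hv]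
      have hr : Set.range f₀ = {1, 0} := by
        obtain ⟨a, ha⟩ := Finset.card_pos.1 (by omega : 0 < T.card)
        obtain ⟨b, hb⟩ := Finset.card_pos.1 (by omega : 0 < Tᶜ.card)
        rw [mem_compl] at hb
        ext x
        simp only [Set.mem_range, Set.mem_insert_iff, Set.mem_singleton_iff, hf₀]
        constructor
        · rintro ⟨v, rfl⟩
          split_ifs <;> simp
        · rintro (rfl | rfl)
          · exact ⟨a, if_pos ha⟩
          · exact ⟨b, if_neg hb⟩
      have hr2 : (Set.range f₀).ncard = 2 := by rw [hr]; exact Set.ncard_pair (by norm_num)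
      obtain ⟨f, -, hfk, hf⟩ := exists_saturating_coloring hw h f₀ (by
        rw [hr2]
        refine lt_of_eq_of_lt ?_ hTc
        simp only [colorCost, cutCost_eq, hf₀eq]) (by omega)
      have half : ∀ A : Finset V, A.card + 2 * k ≤ n → 3 * k ≤ A.card →
          ((smallCuts w s t).filter fun S => ∀ u v, u ∉ A → v ∉ A → f u = f v →
            (u ∈ S ↔ v ∈ S)).card ≤ 4 * D * (A.card - k) := by
        intro A hA1 hA2
        -- Keep the vertices of `A` and contract each colour class outside `A` to a point.
        set φ : V → V ⊕ ℕ := fun v => if v ∈ A then Sum.inl v else Sum.inr (f v) with hφ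
        have hcard : Fintype.card (Set.range φ) ≤ A.card + k := by
          rw [← Nat.card_eq_fintype_card]
          change (Set.range φ).ncard ≤ _
          calc (Set.range φ).ncard ≤ (Sum.inl '' (A : Set V) ∪ Sum.inr '' (Set.range f)).ncard := by
                refine Set.ncard_le_ncard ?_
                  ((A.finite_toSet.image _).union ((Set.finite_range f).image _))
                rintro _ ⟨v, rfl⟩
                by_cases hv : v ∈ A
                · exact Or.inl ⟨v, hv, by simp [hφ, hv]⟩
                · exact Or.inr ⟨f v, ⟨v, rfl⟩, by simp [hφ, hv]⟩
            _ ≤ _ := Set.ncard_union_le _ _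
            _ ≤ A.card + k := by
                refine add_le_add ?_ ?_
                · rw [Set.ncard_image_of_injective _ Sum.inl_injective, Set.ncard_coe_finset]
                · rw [Set.ncard_image_of_injective _ Sum.inr_injective]
                  exact hfk.le
        have h1 := ih _ (by omega) (Set.range φ) (Set.rangeFactorization φ ∘ s)
          (Set.rangeFactorization φ ∘ t) rfl (h.contract Set.rangeFactorization_surjective)
        refine (card_saturated_smallCuts_le w s t (Set.rangeFactorization φ) _ ?_).trans
          (h1.trans ?_)
        · intro S hS
          rw [mem_filter] at hS
          refine ⟨hS.1, fun u v huv => ?_⟩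
          have huv : φ u = φ v := congrArg Subtype.val huv
          by_cases hu : u ∈ A <;> by_cases hv : v ∈ A
          · simp only [hφ, hu, hv, if_true, Sum.inl.injEq] at huv
            rw [huv]
          · simp [hφ, hu, hv] at huv
          · simp [hφ, hu, hv] at huv
          · simp only [hφ, hu, hv, if_false, Sum.inr.injEq] at huv
            exact hS.2 u v hu hv huv
        -- Since `A` has at least `3k` vertices, the maximum is at most `A.card + k`.
        · exact Nat.mul_le_mul_left _ (by omega)
      have hsplit : smallCuts w s t ⊆
          ((smallCuts w s t).filter fun S => ∀ u v, u ∉ T → v ∉ T → f u = f v →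
            (u ∈ S ↔ v ∈ S)) ∪
          ((smallCuts w s t).filter fun S => ∀ u v, u ∉ Tᶜ → v ∉ Tᶜ → f u = f v →
            (u ∈ S ↔ v ∈ S)) := by
        intro S hS
        have hS2 := mem_smallCuts.1 hS
        -- The edges of the cut inside `Tᶜ` and those inside `T` are disjoint and weigh less than 2
        -- together, so one of the two parts weighs less than 1 and `S` splits no class of `f`
        -- there.
        have hsum : insideCost w s t f₀ (S ∩ Tᶜ) + insideCost w s t f₀ (S ∩ T) ≤
            cutCost w s t S := by
          rw [cutCost_eq, insideCost, insideCost, ← sum_add_distrib]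
          refine sum_le_sum fun e _ => ?_
          have hwe := hw e
          simp only [hf₀eq, mem_inter, mem_compl]
          by_cases h1 : s e ∈ T <;> by_cases h2 : t e ∈ T
          · rw [zeroIf_pos (by simp [h1, h2]), zero_add]
            exact zeroIf_le_of_imp (by simp only [h1, h2]; tauto) hwe
          · rw [zeroIf_pos (by simp [h1, h2]), zeroIf_pos (by simp [h1, h2]), add_zero]
            exact zeroIf_nonneg _ hwe
          · rw [zeroIf_pos (by simp [h1, h2]), zeroIf_pos (by simp [h1, h2]), add_zero]
            exact zeroIf_nonneg _ hwe
          · rw [zeroIf_pos (p := _ → ((_ ∧ s e ∈ T) ↔ _)) (by simp [h1, h2]), add_zero]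
            exact zeroIf_le_of_imp (by simp only [h1, h2]; tauto) hwe
        rw [mem_union, mem_filter, mem_filter]
        rcases lt_or_ge (insideCost w s t f₀ (S ∩ Tᶜ)) 1 with h1 | h1
        · refine Or.inl ⟨hS, fun u v hu hv huv => ?_⟩
          simpa [hu, hv] using hf _ h1 u v huv
        · refine Or.inr ⟨hS, fun u v hu hv huv => ?_⟩
          have hu : u ∈ T := by simpa using hu
          have hv : v ∈ T := by simpa using hv
          simpa [hu, hv] using hf (S ∩ T) (by linarith) u v huv
      calc (smallCuts w s t).card ≤ _ := Finset.card_le_card hsplit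
        _ ≤ _ := Finset.card_union_le _ _
        _ ≤ 4 * D * (T.card - k) + 4 * D * (Tᶜ.card - k) :=
            add_le_add (half T (by omega) hT1) (half Tᶜ (by omega) hT2)
        _ = 4 * D * (max n (4 * k) - 2 * k) := by
            rw [← mul_add]
            congr 1
            omega
    · push Not at hT
      have hsub : smallCuts w s t ⊆ ((smallCuts w s t).filter fun S => S.card < 3 * k) ∪
          ((smallCuts w s t).filter fun S => S.card < 3 * k).image compl := by
        intro S hS
        rw [mem_union, mem_image]
        by_cases h1 : S.card < 3 * k
        · exact Or.inl (mem_filter.2 ⟨hS, h1⟩)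
        · refine Or.inr ⟨Sᶜ, mem_filter.2 ⟨?_, hT S hS (by omega)⟩, compl_compl S⟩
          rw [mem_smallCuts] at hS ⊢
          rwa [cutCost_compl]
      have hb := card_bounded_smallCuts_le hw h hk (3 * k)
      rw [hn] at hb
      calc (smallCuts w s t).card ≤ _ := Finset.card_le_card hsub
        _ ≤ _ := Finset.card_union_le _ _
        _ ≤ (n + 1) * D + (n + 1) * D := add_le_add hb (Finset.card_image_le.trans hb)
        _ = D * (2 * (n + 1)) := by ring
        _ ≤ D * (4 * (max n (4 * k) - 2 * k)) := Nat.mul_le_mul_left _ (by omega)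
        _ = _ := by ring

/-- The number of cuts of weight less than `2 / k` times the weight of a minimum `k`-cut is linear
in the number of vertices. -/
theorem card_smallCuts_le {V : Type u} [Fintype V] {w : E → ℝ} (hw : ∀ e, 0 ≤ w e) {s t : E → V}
    {k : ℕ} (hk : 2 ≤ k) (h : ColoringBound w s t k) (hkV : k ≤ Fintype.card V) :
    (smallCuts w s t).card ≤ 8 * (k * (3 * k) + 1) ^ (3 * k) * Fintype.card V := by
  refine (card_smallCuts_le_aux hw hk _ V s t rfl h).trans ?_
  calc _ ≤ 4 * (k * (3 * k) + 1) ^ (3 * k) * (2 * Fintype.card V) :=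
        Nat.mul_le_mul_left _ (by omega)
    _ = _ := by ring

end Multigraph

/-! ### Contracted graphs as equivalence relations. -/

namespace WeightedGraph

open Finset

variable {V : Type u}

theorem mem_liveEdges [Fintype V] (G : WeightedGraph V) (r : Setoid V) (a b : V) :
    s(a, b) ∈ G.liveEdges r ↔ G.graph.Adj a b ∧ ¬ r a b := by
  simp only [liveEdges, mem_filter, mem_univ, true_and, SimpleGraph.mem_edgeSet, Sym2.map_mk,
    Sym2.mk_isDiag_iff]
  rw [Quotient.eq]

theorem contract_apply_self (r : Setoid V) (a b : V) : contract r s(a, b) a b :=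
  (le_sup_right : _ ≤ contract r s(a, b)) (Relation.EqvGen.rel _ _ rfl)

theorem le_contract (r : Setoid V) (e : Sym2 V) : r ≤ contract r e := le_sup_left

theorem contract_le {r σ : Setoid V} (h : r ≤ σ) {a b : V} (hab : σ a b) :
    contract r s(a, b) ≤ σ := by
  refine sup_le h (Setoid.eqvGen_le fun x y hxy => ?_)
  rcases Sym2.eq_iff.1 hxy with ⟨rfl, rfl⟩ | ⟨rfl, rfl⟩
  · exact hab
  · exact σ.symm hab

open Classical in
-- Describing the contraction as the kernel of the map which redirects the class of `a` to that of
-- `b` makes its classes countable: the image misses exactly the class of `a` when the two differ.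
theorem contract_eq_ker (r : Setoid V) (a b : V) :
    contract r s(a, b) =
      Setoid.ker fun v => if r v a then (Quotient.mk r b) else Quotient.mk r v := by
  refine le_antisymm (contract_le ?_ ?_) ?_
  · intro x y hxy
    change (if r x a then _ else _) = if r y a then _ else _
    have h1 : r x a ↔ r y a := ⟨fun h => r.trans (r.symm hxy) h, fun h => r.trans hxy h⟩
    have h2 : Quotient.mk r x = Quotient.mk r y := Quotient.sound hxy
    simp only [h1, h2]
  · change (if r a a then _ else _) = if r b a then _ else _
    rw [if_pos (r.refl a)]
    split_ifs <;> rfl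
  · intro x y hxy
    change (if r x a then _ else _) = (if r y a then _ else _) at hxy
    have hr : ∀ u v, r u v → contract r s(a, b) u v := fun u v h => le_contract r _ h
    have hab := contract_apply_self r a b
    split_ifs at hxy with h1 h2 h2
    · exact hr _ _ (r.trans h1 (r.symm h2))
    · exact Setoid.trans' _ (hr _ _ h1) (Setoid.trans' _ hab (hr _ _ (Quotient.exact hxy)))
    · exact Setoid.trans' _ (hr _ _ (Quotient.exact hxy))
        (Setoid.trans' _ (Setoid.symm' _ hab) (Setoid.symm' _ (hr _ _ h2)))
    · exact hr _ _ (Quotient.exact hxy)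

theorem card_contract_add_one [Finite V] (r : Setoid V) {a b : V} (h : ¬ r a b) :
    Nat.card (Quotient (contract r s(a, b))) + 1 = Nat.card (Quotient r) := by
  classical
  rw [contract_eq_ker, Nat.card_congr (Setoid.quotientKerEquivRange _)]
  have h1 : (Set.range fun v => if r v a then (Quotient.mk r b) else Quotient.mk r v) =
      {Quotient.mk r a}ᶜ := by
    ext x
    simp only [Set.mem_range, Set.mem_compl_iff, Set.mem_singleton_iff]
    constructor
    · rintro ⟨v, rfl⟩ hv
      split_ifs at hv with h2
      · exact h (r.symm (Quotient.exact hv))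
      · exact h2 (Quotient.exact hv)
    · induction x using Quotient.inductionOn with
      | h v => exact fun hv => ⟨v, if_neg fun h2 => hv (Quotient.sound h2)⟩
  rw [h1]
  change Set.ncard _ + 1 = _
  rw [Set.ncard_compl, Set.ncard_singleton]
  have : Nonempty (Quotient r) := ⟨Quotient.mk r a⟩
  have := Nat.card_pos (α := Quotient r)
  omega

theorem card_quotient_le [Finite V] {r σ : Setoid V} (h : r ≤ σ) :
    Nat.card (Quotient σ) ≤ Nat.card (Quotient r) :=
  Nat.card_le_card_of_surjective (Quotient.map' id h : Quotient r → Quotient σ) fun x => by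
    induction x using Quotient.inductionOn' with
    | h v => exact ⟨Quotient.mk'' v, rfl⟩

theorem card_quotient_lt [Finite V] {r σ : Setoid V} (h : r < σ) :
    Nat.card (Quotient σ) < Nat.card (Quotient r) := by
  obtain ⟨a, b, hab, hn⟩ : ∃ a b, σ a b ∧ ¬ r a b := by
    by_contra! hcon
    exact h.not_ge fun a b hab => hcon a b hab
  have h1 := card_contract_add_one r hn
  have h2 := card_quotient_le (contract_le h.le hab)
  omega

/-- The weight of the contracted graph. -/
noncomputable def liveSum [Fintype V] (G : WeightedGraph V) (r : Setoid V) : ℝ :=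
  ∑ e ∈ G.liveEdges r, (G.weight e : ℝ)

theorem cast_cutWeight (G : WeightedGraph V) (F : Finset (Sym2 V)) :
    (G.cutWeight F : ℝ) = ∑ e ∈ F, (G.weight e : ℝ) := by
  simp [cutWeight]

theorem mem_edgeSet_of_mem_liveEdges [Fintype V] {G : WeightedGraph V} {r : Setoid V} {e : Sym2 V}
    (he : e ∈ G.liveEdges r) : e ∈ G.graph.edgeSet := by
  simp only [liveEdges, mem_filter] at he
  exact he.2.1

theorem weight_pos_of_mem_liveEdges [Fintype V] {G : WeightedGraph V} {r : Setoid V} {e : Sym2 V}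
    (he : e ∈ G.liveEdges r) : (0 : ℝ) < G.weight e := by
  exact_mod_cast G.weight_pos e (mem_edgeSet_of_mem_liveEdges he)

theorem liveEdges_anti [Fintype V] (G : WeightedGraph V) {r σ : Setoid V} (h : r ≤ σ) :
    G.liveEdges σ ⊆ G.liveEdges r := by
  intro e
  induction e using Sym2.ind with
  | h a b =>
    rw [mem_liveEdges, mem_liveEdges]
    exact fun h1 => ⟨h1.1, fun h2 => h1.2 (h h2)⟩

/-- An edge which is not deleted joins vertices of the same class, so each remaining component lies
in one class. -/
theorem isKCut_liveEdges [Fintype V] (G : WeightedGraph V) {k : ℕ} {σ : Setoid V}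
    (h : k ≤ Nat.card (Quotient σ)) : G.IsKCut k (G.liveEdges σ) := by
  refine ⟨fun e he => mem_edgeSet_of_mem_liveEdges he, h.trans ?_⟩
  have hle : (G.graph.deleteEdges (G.liveEdges σ : Set (Sym2 V))).reachableSetoid ≤ σ := by
    intro a b hab
    replace hab := (SimpleGraph.reachable_iff_reflTransGen a b).1 hab
    induction hab with
    | refl => exact σ.refl a
    | tail _ hbc ih =>
      refine σ.trans ih ?_
      rw [SimpleGraph.deleteEdges_adj, mem_coe, mem_liveEdges] at hbc
      by_contra hcon
      exact hbc.2 ⟨hbc.1, hcon⟩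
  exact card_quotient_le hle

/-- The partition into the connected components which remain after deleting `F`. -/
def cutSetoid (G : WeightedGraph V) (F : Finset (Sym2 V)) : Setoid V :=
  (G.graph.deleteEdges (F : Set (Sym2 V))).reachableSetoid

/-! ### Structure of a minimum `k`-cut. -/

namespace IsMinKCut

theorem le_card {G : WeightedGraph V} {k : ℕ} {F : Finset (Sym2 V)} (hF : G.IsMinKCut k F) :
    k ≤ Nat.card (Quotient (G.cutSetoid F)) := hF.1.2

variable [Fintype V] {G : WeightedGraph V} {k : ℕ} {F : Finset (Sym2 V)}

theorem cutWeight_le (hF : G.IsMinKCut k F) {σ : Setoid V} (h : k ≤ Nat.card (Quotient σ)) :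
    G.cutWeight F ≤ G.cutWeight (G.liveEdges σ) :=
  hF.2 _ (G.isKCut_liveEdges h)

/-- An edge of `F` inside a remaining component could be dropped, which contradicts minimality
because weights are positive. -/
theorem liveEdges_cutSetoid (hF : G.IsMinKCut k F) : G.liveEdges (G.cutSetoid F) = F := by
  classical
  have hsub : G.liveEdges (G.cutSetoid F) ⊆ F := by
    intro e
    induction e using Sym2.ind with
    | h a b =>
      rw [mem_liveEdges]
      intro h
      by_contra hn
      refine h.2 ?_
      have : (G.graph.deleteEdges (F : Set (Sym2 V))).Adj a b :=
        SimpleGraph.deleteEdges_adj.2 ⟨h.1, hn⟩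
      exact this.reachable
  refine hsub.antisymm fun f hf => ?_
  by_contra hn
  have h1 := hF.cutWeight_le hF.le_card
  have h2 : G.cutWeight (G.liveEdges (G.cutSetoid F)) < G.cutWeight F :=
    Finset.sum_lt_sum_of_subset hsub hf hn (G.weight_pos f (hF.1.1 f hf))
      fun e he _ => (G.weight_pos e (hF.1.1 e he)).le
  exact absurd h1 h2.not_ge

/-- With more than `k` components, merging the two ends of an edge of `F` would leave a cheaper
`k`-cut. For empty `F` there may be more than `k` components. -/
theorem card_eq_of_nonempty (hF : G.IsMinKCut k F) (hne : F.Nonempty) :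
    Nat.card (Quotient (G.cutSetoid F)) = k := by
  refine le_antisymm ?_ hF.le_card
  by_contra! hlt
  obtain ⟨f, hf⟩ := hne
  induction f using Sym2.ind with
  | h a b =>
    have hf' := hf
    rw [← hF.liveEdges_cutSetoid] at hf'
    have hn := ((G.mem_liveEdges _ a b).1 hf').2
    have h1 := card_contract_add_one _ hn
    have h2 := hF.cutWeight_le (show k ≤ Nat.card (Quotient (contract (G.cutSetoid F) s(a, b)))
      by omega)
    have hsub := G.liveEdges_anti (le_contract (G.cutSetoid F) s(a, b))
    rw [hF.liveEdges_cutSetoid] at hsub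
    have h3 : G.cutWeight (G.liveEdges (contract (G.cutSetoid F) s(a, b))) < G.cutWeight F := by
      refine Finset.sum_lt_sum_of_subset hsub hf ?_ (G.weight_pos _ (hF.1.1 _ hf))
        fun e he _ => (G.weight_pos e (hF.1.1 e he)).le
      rw [mem_liveEdges]
      exact fun h => h.2 (contract_apply_self _ a b)
    exact absurd h2 h3.not_ge

theorem subset_liveEdges (hF : G.IsMinKCut k F) {r : Setoid V} (hr : r ≤ G.cutSetoid F) :
    F ⊆ G.liveEdges r := by
  have := G.liveEdges_anti hr
  rwa [hF.liveEdges_cutSetoid] at this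

theorem contract_le_cutSetoid [DecidableEq V] {r : Setoid V} (hr : r ≤ G.cutSetoid F) {e : Sym2 V}
    (he : e ∈ G.liveEdges r \ F) : contract r e ≤ G.cutSetoid F := by
  induction e using Sym2.ind with
  | h a b =>
    rw [mem_sdiff, mem_liveEdges] at he
    have : (G.graph.deleteEdges (F : Set (Sym2 V))).Adj a b :=
      SimpleGraph.deleteEdges_adj.2 ⟨he.1.1, he.2⟩
    exact contract_le hr this.reachable

theorem liveEdges_sdiff_nonempty [DecidableEq V] {r : Setoid V} (hr : r < G.cutSetoid F) :
    (G.liveEdges r \ F).Nonempty := by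
  by_contra hcon
  rw [not_nonempty_iff_eq_empty, sdiff_eq_empty_iff_subset] at hcon
  refine hr.not_ge fun a b hab => ?_
  replace hab := (SimpleGraph.reachable_iff_reflTransGen a b).1 hab
  induction hab with
  | refl => exact r.refl a
  | tail _ hbc ih =>
    refine r.trans ih ?_
    rw [SimpleGraph.deleteEdges_adj] at hbc
    by_contra hn
    exact hbc.2 (hcon ((G.mem_liveEdges _ _ _).2 ⟨hbc.1, hn⟩))

end IsMinKCut

/-! ### The contraction process as a Markov chain. -/

/-- The probability that the algorithm returns `F` when it performs `j` iterations of the loop,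
starting with the contracted graph given by `r`. -/
noncomputable def outputProb [Fintype V] (G : WeightedGraph V) (k : ℕ) (F : Finset (Sym2 V))
    (j : ℕ) (r : Setoid V) : ℝ :=
  ((((fun p : PMF (Setoid V) => p.bind (G.loopStep k))^[j] (PMF.pure r)).map G.liveEdges) F).toReal

theorem outputProb_card_bot [Fintype V] (G : WeightedGraph V) (k : ℕ) (F : Finset (Sym2 V)) :
    G.outputProb k F (Fintype.card V) ⊥ = (G.kargerStein k F).toReal := rfl

theorem outputProb_nonneg [Fintype V] (G : WeightedGraph V) (k : ℕ) (F : Finset (Sym2 V)) (j : ℕ)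
    (r : Setoid V) : 0 ≤ G.outputProb k F j r := ENNReal.toReal_nonneg

/-- This allows conditioning on the first iteration, while iteration of `bind` naturally exposes the
last one. -/
theorem iterate_bind_eq {α : Type*} (step : α → PMF α) (j : ℕ) (p : PMF α) :
    (fun p : PMF α => p.bind step)^[j] p =
      p.bind fun a => (fun p : PMF α => p.bind step)^[j] (PMF.pure a) := by
  induction j with
  | zero => exact (PMF.bind_pure p).symm
  | succ j ih =>
    simp only [Function.iterate_succ_apply']
    rw [ih, PMF.bind_bind]

theorem outputProb_of_halt [Fintype V] (G : WeightedGraph V) {k : ℕ} {r : Setoid V}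
    (h : ¬ (k < Nat.card (Quotient r) ∧ (G.liveEdges r).Nonempty)) (j : ℕ) :
    G.outputProb k (G.liveEdges r) j r = 1 := by
  have h1 : (fun p : PMF (Setoid V) => p.bind (G.loopStep k))^[j] (PMF.pure r) = PMF.pure r := by
    refine Function.iterate_fixed ?_ j
    rw [PMF.pure_bind, loopStep, dif_neg h]
  rw [outputProb, h1, PMF.pure_map, PMF.pure_apply, if_pos rfl, ENNReal.toReal_one]

theorem outputProb_succ [Fintype V] (G : WeightedGraph V) {k : ℕ} (F : Finset (Sym2 V))
    {r : Setoid V} (h1 : k < Nat.card (Quotient r)) (h2 : (G.liveEdges r).Nonempty) (j : ℕ) :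
    G.outputProb k F (j + 1) r =
      (∑ e ∈ G.liveEdges r, (G.weight e : ℝ) * G.outputProb k F j (contract r e)) /
        G.liveSum r := by
  classical
  have hsum : ∑' e, G.liveWeight r e = ENNReal.ofReal (G.liveSum r) := by
    rw [tsum_fintype, liveSum, ENNReal.ofReal_sum_of_nonneg
      fun e he => (weight_pos_of_mem_liveEdges he).le]
    simp only [liveWeight, Finset.sum_ite_mem, Finset.univ_inter]
  have hpos : 0 ≤ G.liveSum r := Finset.sum_nonneg fun e he => (weight_pos_of_mem_liveEdges he).le
  rw [outputProb, Function.iterate_succ_apply]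
  change ((((fun p : PMF (Setoid V) => p.bind (G.loopStep k))^[j]
    ((PMF.pure r).bind (G.loopStep k))).map G.liveEdges) F).toReal = _
  rw [PMF.pure_bind, loopStep, dif_pos ⟨h1, h2⟩, iterate_bind_eq, PMF.bind_map, PMF.map_bind,
    PMF.bind_apply, tsum_fintype, ENNReal.toReal_sum fun e _ =>
      ENNReal.mul_ne_top (PMF.apply_ne_top _ _) (PMF.apply_ne_top _ _), Finset.sum_div,
    ← Finset.sum_subset (Finset.subset_univ (G.liveEdges r))]
  · refine Finset.sum_congr rfl fun e he => ?_
    rw [ENNReal.toReal_mul, sampleEdge, PMF.normalize_apply, hsum, ENNReal.toReal_mul,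
      ENNReal.toReal_inv, ENNReal.toReal_ofReal hpos, liveWeight, if_pos he,
      ENNReal.toReal_ofReal (weight_pos_of_mem_liveEdges he).le]
    change _ * _ * G.outputProb k F j (contract r e) = _
    ring
  · intro e _ he
    rw [sampleEdge, PMF.normalize_apply, liveWeight, if_neg he]
    simp

/-- Lower bounds for the success probability are verified one contraction at a time. -/
theorem IsMinKCut.le_outputProb [Fintype V] [DecidableEq V] {G : WeightedGraph V} {k : ℕ}
    {F : Finset (Sym2 V)} (hF : G.IsMinKCut k F) (Φ : Setoid V → ℝ)
    (hΦ₁ : Φ (G.cutSetoid F) ≤ 1)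
    (hΦ : ∀ r < G.cutSetoid F,
      (∀ j, Nat.card (Quotient r) ≤ j → Φ r ≤ G.outputProb k F j r) ∨
      Φ r * G.liveSum r ≤ ∑ e ∈ G.liveEdges r \ F, (G.weight e : ℝ) * Φ (contract r e))
    (j : ℕ) (r : Setoid V) (hr : r ≤ G.cutSetoid F) (hj : Nat.card (Quotient r) ≤ j) :
    Φ r ≤ G.outputProb k F j r := by
  induction j generalizing r with
  | zero =>
    rcases hr.lt_or_eq with hlt | rfl
    · have := card_quotient_lt hlt
      omega
    · refine hΦ₁.trans (le_of_eq ?_)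
      have h1 := G.outputProb_of_halt (k := k) (r := G.cutSetoid F) (fun h => by omega) 0
      rw [hF.liveEdges_cutSetoid] at h1
      exact h1.symm
  | succ j ih =>
    rcases hr.lt_or_eq with hlt | rfl
    · rcases hΦ r hlt with h1 | h1
      · exact h1 _ hj
      · have hk : k < Nat.card (Quotient r) := lt_of_le_of_lt hF.le_card (card_quotient_lt hlt)
        have hne := (IsMinKCut.liveEdges_sdiff_nonempty hlt).mono sdiff_subset
        have hpos : 0 < G.liveSum r :=
          Finset.sum_pos (fun e he => weight_pos_of_mem_liveEdges he) hne
        rw [G.outputProb_succ F hk hne, le_div_iff₀ hpos]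
        -- Sampling an edge of `F` contributes a nonnegative probability, which is discarded.
        refine h1.trans (le_trans (Finset.sum_le_sum fun e he => ?_)
          (Finset.sum_le_sum_of_subset_of_nonneg sdiff_subset fun e he _ =>
            mul_nonneg (weight_pos_of_mem_liveEdges he).le (G.outputProb_nonneg _ _ _ _)))
        refine mul_le_mul_of_nonneg_left (ih _ (IsMinKCut.contract_le_cutSetoid hr he) ?_)
          (weight_pos_of_mem_liveEdges (mem_sdiff.1 he).1).le
        have he' := (mem_sdiff.1 he).1
        induction e using Sym2.ind with
        | h a b =>
          have := card_contract_add_one r ((G.mem_liveEdges r a b).1 he').2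
          omega
    · refine hΦ₁.trans (le_of_eq ?_)
      have h1 := G.outputProb_of_halt (k := k) (r := G.cutSetoid F) (fun h => by
        rw [hF.liveEdges_cutSetoid] at h
        have := hF.card_eq_of_nonempty h.2
        omega) (j + 1)
      rw [hF.liveEdges_cutSetoid] at h1
      exact h1.symm

end WeightedGraph

/-! ### Degrees and isolating partitions. -/

namespace Multigraph

open Finset

variable {E : Type*} [Fintype E]

theorem sum_cutCost_singleton {V : Type*} [Fintype V] (w : E → ℝ) (s t : E → V) :
    ∑ a, cutCost w s t {a} = 2 * colorCost w s t id := by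
  classical
  simp only [cutCost_eq, colorCost, mem_singleton]
  rw [sum_comm, mul_sum]
  refine sum_congr rfl fun e _ => ?_
  by_cases h : s e = t e
  · simp [h, zeroIf]
  · rw [id, id, zeroIf_neg h, two_mul]
    have h1 : ∀ a, zeroIf (s e = a ↔ t e = a) (w e) =
        (if s e = a then w e else 0) + (if t e = a then w e else 0) := by
      intro a
      by_cases h1 : s e = a
      · have h2 : t e ≠ a := fun h2 => h (h1.trans h2.symm)
        rw [zeroIf_neg (by simp [h1, h2]), if_pos h1, if_neg h2, add_zero]
      · by_cases h2 : t e = a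
        · rw [zeroIf_neg (by simp [h1, h2]), if_neg h1, if_pos h2, zero_add]
        · rw [zeroIf_pos (by simp [h1, h2]), if_neg h1, if_neg h2, add_zero]
    simp only [h1, sum_add_distrib, Finset.sum_ite_eq, mem_univ, if_true]

open Classical in
/-- The cost of the partition which isolates the vertices of `J` from each other and the rest. -/
theorem ColoringBound.le_isolate {V : Type*} [Fintype V] {w : E → ℝ} {s t : E → V} {k : ℕ}
    (h : ColoringBound w s t k) (hk : 1 ≤ k) {J : Finset V} (hJ : J.card = k - 1)
    (hV : k ≤ Fintype.card V) :
    (k : ℝ) ≤ ∑ e, zeroIf (s e = t e ∨ s e ∉ J ∧ t e ∉ J) (w e) := by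
  have hJ' : J.card < (univ : Finset V).card := by rw [Finset.card_univ]; omega
  obtain ⟨x, -, hx⟩ := Finset.exists_mem_notMem_of_card_lt_card hJ'
  have h1 := h.le_colorCost (fun v => if v ∈ J then some v else none) (by
    have h2 : (insert none (J.image some)).card = k := by
      rw [card_insert_of_notMem (by simp), card_image_of_injective _ (Option.some_injective _)]
      omega
    rw [← h2, ← Set.ncard_coe_finset]
    refine Set.ncard_le_ncard (fun z hz => ?_) (Set.finite_range _)
    simp only [coe_insert, coe_image, Set.mem_insert_iff, Set.mem_image, mem_coe] at hz
    rcases hz with rfl | ⟨v, hv, rfl⟩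
    · exact ⟨x, if_neg hx⟩
    · exact ⟨v, if_pos hv⟩)
  refine h1.trans_eq (sum_congr rfl fun e _ => ?_)
  congr 1
  by_cases hs : s e ∈ J <;> by_cases ht : t e ∈ J
  · simp [hs, ht]
  · simp only [hs, ht]
    simp only [if_true, if_false, reduceCtorEq, not_true, false_and, or_false, eq_iff_iff,
      false_iff]
    exact fun h => ht (h ▸ hs)
  · simp only [hs, ht]
    simp only [if_true, if_false, reduceCtorEq, not_true, and_false, or_false, eq_iff_iff,
      false_iff]
    exact fun h => hs (h ▸ ht)
  · simp [hs, ht]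

/-- The average cost of isolating `k - 1` vertices bounds the total weight from below. -/
theorem ColoringBound.mul_choose_le {V : Type*} [Fintype V] {w : E → ℝ}
    {s t : E → V} {k : ℕ} (h : ColoringBound w s t k) (hk : 1 ≤ k) (hV : k ≤ Fintype.card V) :
    colorCost w s t id * ((Fintype.card V - 2).choose (k - 1) : ℝ) ≤
      (colorCost w s t id - k) * ((Fintype.card V).choose (k - 1) : ℝ) := by
  classical
  have h1 : ∑ J ∈ powersetCard (k - 1) (univ : Finset V), (k : ℝ) ≤
      ∑ J ∈ powersetCard (k - 1) (univ : Finset V),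
        ∑ e, zeroIf (s e = t e ∨ s e ∉ J ∧ t e ∉ J) (w e) :=
    Finset.sum_le_sum fun J hJ => h.le_isolate hk (mem_powersetCard.1 hJ).2 hV
  rw [sum_const, card_powersetCard, Finset.card_univ, nsmul_eq_mul, sum_comm] at h1
  have h2 : ∀ e, ∑ J ∈ powersetCard (k - 1) (univ : Finset V),
      zeroIf (s e = t e ∨ s e ∉ J ∧ t e ∉ J) (w e) = zeroIf (s e = t e) (w e) *
        (((Fintype.card V).choose (k - 1) : ℝ) - ((Fintype.card V - 2).choose (k - 1) : ℝ)) := by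
    intro e
    by_cases he : s e = t e
    · simp [he, zeroIf]
    -- A non-loop goes unpaid exactly for those `J` which avoid both of its ends.
    · have h3 : (univ.powersetCard (k - 1)).filter (fun J : Finset V => s e ∉ J ∧ t e ∉ J) =
          ((univ \ {s e, t e} : Finset V)).powersetCard (k - 1) := by
        ext J
        simp only [mem_filter, mem_powersetCard, Finset.subset_univ, true_and, subset_sdiff,
          Finset.disjoint_insert_right, Finset.disjoint_singleton_right]
        tauto
      have h4 : ((univ.powersetCard (k - 1)).filter
          (fun J : Finset V => s e ∉ J ∧ t e ∉ J)).card =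
            (Fintype.card V - 2).choose (k - 1) := by
        rw [h3, card_powersetCard, Finset.card_sdiff_of_subset (Finset.subset_univ _),
          Finset.card_univ, Finset.card_pair he]
      have h5 := Finset.card_filter_add_card_filter_not (s := univ.powersetCard (k - 1))
        (fun J : Finset V => s e ∉ J ∧ t e ∉ J)
      rw [h4, card_powersetCard, Finset.card_univ] at h5
      have h6 : ∀ J : Finset V, zeroIf (s e = t e ∨ s e ∉ J ∧ t e ∉ J) (w e) =
          if ¬ (s e ∉ J ∧ t e ∉ J) then w e else 0 := by
        intro J
        by_cases hJ : s e ∉ J ∧ t e ∉ J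
        · rw [zeroIf_pos (Or.inr hJ), if_neg (not_not.2 hJ)]
        · rw [zeroIf_neg (not_or.2 ⟨he, hJ⟩), if_pos hJ]
      simp only [h6]
      rw [← Finset.sum_filter, sum_const, nsmul_eq_mul, zeroIf_neg he, ← h5]
      push_cast
      ring
  simp only [h2, ← Finset.sum_mul] at h1
  change _ ≤ colorCost w s t id * _ at h1
  linarith

open Classical in
-- Isolating `k - 1` vertices of degree below 1 would give `k` classes at a cost below `k - 1`.
theorem ColoringBound.card_light_lt {V : Type*} [Fintype V] {w : E → ℝ} (hw : ∀ e, 0 ≤ w e)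
    {s t : E → V} {k : ℕ} (h : ColoringBound w s t k) (hk : 2 ≤ k) (hV : k ≤ Fintype.card V) :
    (univ.filter fun a => cutCost w s t {a} < 1).card < k := by
  by_contra! hcon
  obtain ⟨J, hJ, hJc⟩ := Finset.exists_subset_card_eq (show k - 1 ≤ _ from (Nat.sub_le k 1).trans hcon)
  have h1 := h.le_isolate (by omega) hJc hV
  have h2 : ∑ e, zeroIf (s e = t e ∨ s e ∉ J ∧ t e ∉ J) (w e) ≤
      ∑ a ∈ J, cutCost w s t {a} := by
    simp only [cutCost_eq, mem_singleton]
    rw [sum_comm]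
    refine sum_le_sum fun e _ => ?_
    by_cases he : s e = t e ∨ s e ∉ J ∧ t e ∉ J
    · rw [zeroIf_pos he]
      exact sum_nonneg fun a _ => zeroIf_nonneg _ (hw e)
    · rw [zeroIf_neg he]
      have hpos : ∀ a ∈ J, 0 ≤ zeroIf (s e = a ↔ t e = a) (w e) := fun a _ =>
        zeroIf_nonneg _ (hw e)
      obtain ⟨hne, hor⟩ := not_or.1 he
      by_cases hs : s e ∈ J
      · refine le_trans ?_ (Finset.single_le_sum hpos hs)
        rw [zeroIf_neg (by simpa using Ne.symm hne)]
      · have ht : t e ∈ J := by_contra fun ht => hor ⟨hs, ht⟩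
        refine le_trans ?_ (Finset.single_le_sum hpos ht)
        rw [zeroIf_neg (by simpa using hne)]
  have h3 : ∑ a ∈ J, cutCost w s t {a} < ∑ a ∈ J, (1 : ℝ) :=
    Finset.sum_lt_sum_of_nonempty (Finset.card_pos.1 (by omega)) fun a ha =>
      (mem_filter.1 (hJ ha)).2
  rw [sum_const, hJc, nsmul_eq_mul, Nat.cast_sub (by omega)] at h3
  push_cast at h3
  linarith

open Classical in
/-- The number of vertices is at most the total weight, up to the vertices of small degree which do
not meet much of the weight `w'`. -/
theorem ColoringBound.card_le {V : Type*} [Fintype V] {w w' : E → ℝ} (hw : ∀ e, 0 ≤ w e)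
    (hw' : ∀ e, 0 ≤ w' e) {s t : E → V} {k : ℕ} (h : ColoringBound w s t k) (hk : 2 ≤ k)
    (hV : k ≤ Fintype.card V) (hsum : ∑ e, w' e ≤ k) {ε : ℝ} (hε : 0 < ε) :
    (Fintype.card V : ℝ) ≤ colorCost w s t id + k + 2 * k / ε +
      (univ.filter fun a => (1 ≤ cutCost w s t {a} ∧ cutCost w s t {a} < 2) ∧
        cutCost w' s t {a} ≤ ε).card := by
  set A := univ.filter fun a => cutCost w s t {a} < 1
  set B := univ.filter fun a => ε < cutCost w' s t {a}
  set M := univ.filter fun a => (1 ≤ cutCost w s t {a} ∧ cutCost w s t {a} < 2) ∧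
        cutCost w' s t {a} ≤ ε
  have hcut : ∀ {w : E → ℝ}, (∀ e, 0 ≤ w e) → ∀ a, 0 ≤ cutCost w s t {a} := fun hw a =>
    sum_nonneg fun e _ => zeroIf_nonneg _ (hw e)
  have hA : (A.card : ℝ) ≤ k := by exact_mod_cast (h.card_light_lt hw hk hV).le
  have hB : (B.card : ℝ) ≤ 2 * k / ε := by
    rw [le_div_iff₀ hε]
    calc (B.card : ℝ) * ε = ∑ a ∈ B, ε := by rw [sum_const, nsmul_eq_mul]
      _ ≤ ∑ a ∈ B, cutCost w' s t {a} := Finset.sum_le_sum fun a ha => (mem_filter.1 ha).2.le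
      _ ≤ ∑ a, cutCost w' s t {a} := Finset.sum_le_sum_of_subset_of_nonneg
          (Finset.subset_univ _) fun a _ _ => hcut hw' a
      _ = 2 * colorCost w' s t id := sum_cutCost_singleton _ _ _
      _ ≤ 2 * ∑ e, w' e := by
          gcongr
          exact Finset.sum_le_sum fun e _ => zeroIf_le _ (hw' e)
      _ ≤ 2 * k := by linarith
  -- Outside `U` all degrees are at least 2, and all degrees sum to twice the total weight.
  set U := A ∪ B ∪ M with hU
  have hUc : (U.card : ℝ) ≤ A.card + B.card + M.card := by
    have h1 := Finset.card_union_le (A ∪ B) M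
    rw [← hU] at h1
    have h2 := Finset.card_union_le A B
    exact_mod_cast (by omega : U.card ≤ A.card + B.card + M.card)
  have hbig : ∀ a ∈ Uᶜ, 2 ≤ cutCost w s t {a} := by
    intro a ha
    by_contra! hlt
    rw [mem_compl, hU, mem_union, mem_union, not_or, not_or] at ha
    simp only [A, B, M, mem_filter, mem_univ, true_and, not_lt] at ha
    exact ha.2 ⟨⟨ha.1.1, hlt⟩, ha.1.2⟩
  have h2 : 2 * (Uᶜ.card : ℝ) ≤ 2 * colorCost w s t id := by
    calc 2 * (Uᶜ.card : ℝ) = ∑ a ∈ Uᶜ, (2 : ℝ) := by rw [sum_const, nsmul_eq_mul, mul_comm]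
      _ ≤ ∑ a ∈ Uᶜ, cutCost w s t {a} := Finset.sum_le_sum hbig
      _ ≤ ∑ a, cutCost w s t {a} := Finset.sum_le_sum_of_subset_of_nonneg
          (Finset.subset_univ _) fun a _ _ => hcut hw a
      _ = _ := sum_cutCost_singleton _ _ _
  have h3 : (U.card : ℝ) + Uᶜ.card = Fintype.card V := by
    exact_mod_cast Finset.card_add_card_compl U
  linarith

end Multigraph

/-! ### Normalized weights and the Karger–Stein bound. -/

namespace WeightedGraph

open Finset Multigraph

section

open Classical

variable {V : Type u}

/-- The first end point of an edge. -/
noncomputable def src (e : Sym2 V) : V := (Quot.out e).1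

/-- The second end point of an edge. -/
noncomputable def tgt (e : Sym2 V) : V := (Quot.out e).2

theorem mk_src_tgt (e : Sym2 V) : s(src e, tgt e) = e := Quot.out_eq e

theorem mem_liveEdges_iff [Fintype V] (G : WeightedGraph V) (r : Setoid V) (e : Sym2 V) :
    e ∈ G.liveEdges r ↔ e ∈ G.graph.edgeSet ∧ ¬ r (src e) (tgt e) := by
  have h := G.mem_liveEdges r (src e) (tgt e)
  rwa [← SimpleGraph.mem_edgeSet, mk_src_tgt] at h

/-- The edge weights, scaled so that the total weight of `F` is `k`. -/
noncomputable def normWeight (G : WeightedGraph V) (k : ℕ) (F : Finset (Sym2 V)) (e : Sym2 V) : ℝ :=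
  if e ∈ G.graph.edgeSet then k / (G.cutWeight F : ℝ) * G.weight e else 0

/-- The normalized weights, restricted to the edges of `F`. -/
noncomputable def normWeightOn (G : WeightedGraph V) (k : ℕ) (F : Finset (Sym2 V))
    (e : Sym2 V) : ℝ :=
  if e ∈ F then G.normWeight k F e else 0

variable {G : WeightedGraph V} {k : ℕ} {F : Finset (Sym2 V)}

theorem IsMinKCut.cutWeight_pos (hF : G.IsMinKCut k F) (hne : F.Nonempty) :
    (0 : ℝ) < G.cutWeight F := by
  exact_mod_cast Finset.sum_pos (fun e he => G.weight_pos e (hF.1.1 e he)) hne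

theorem IsMinKCut.normWeight_nonneg (hF : G.IsMinKCut k F) (hne : F.Nonempty) (e : Sym2 V) :
    0 ≤ G.normWeight k F e := by
  unfold normWeight
  split_ifs with h
  · have h1 : (0 : ℝ) < G.weight e := by exact_mod_cast G.weight_pos e h
    have h2 := hF.cutWeight_pos hne
    positivity
  · exact le_rfl

theorem IsMinKCut.normWeightOn_nonneg (hF : G.IsMinKCut k F) (hne : F.Nonempty) (e : Sym2 V) :
    0 ≤ G.normWeightOn k F e := by
  unfold normWeightOn
  split_ifs
  · exact hF.normWeight_nonneg hne e
  · exact le_rfl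

theorem IsMinKCut.sum_normWeight (hF : G.IsMinKCut k F) (hne : F.Nonempty) :
    ∑ e ∈ F, G.normWeight k F e = k := by
  have h1 : ∑ e ∈ F, G.normWeight k F e = ∑ e ∈ F, k / (G.cutWeight F : ℝ) * G.weight e :=
    sum_congr rfl fun e he => if_pos (hF.1.1 e he)
  rw [h1, ← mul_sum, ← cast_cutWeight, div_mul_cancel₀ _ (hF.cutWeight_pos hne).ne']

theorem sum_liveEdges_normWeight [Fintype V] (G : WeightedGraph V) (k : ℕ) (F : Finset (Sym2 V))
    (r : Setoid V) :
    ∑ e ∈ G.liveEdges r, G.normWeight k F e = k / (G.cutWeight F : ℝ) * G.liveSum r := by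
  rw [liveSum, mul_sum]
  exact sum_congr rfl fun e he => if_pos (mem_edgeSet_of_mem_liveEdges he)

theorem colorCost_eq_sum_liveEdges [Fintype V] (G : WeightedGraph V) (k : ℕ) (F : Finset (Sym2 V))
    {α : Type*} (r : Setoid V) (f : V → α) (hf : ∀ u v, f u = f v ↔ r u v) :
    colorCost (G.normWeight k F) src tgt f = ∑ e ∈ G.liveEdges r, G.normWeight k F e := by
  rw [colorCost, ← Finset.sum_subset (Finset.subset_univ (G.liveEdges r))]
  · refine sum_congr rfl fun e he => zeroIf_neg ?_ _
    rw [hf]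
    exact ((G.mem_liveEdges_iff r e).1 he).2
  · intro e _ he
    rw [mem_liveEdges_iff, not_and_or, not_not] at he
    rcases he with he | he
    · rw [normWeight, if_neg he]
      simp [zeroIf]
    · exact zeroIf_pos ((hf _ _).2 he) _

theorem IsMinKCut.coloringBound [Fintype V] (hF : G.IsMinKCut k F) (hne : F.Nonempty) :
    ColoringBound (G.normWeight k F) src tgt k := by
  intro f hf
  rw [G.colorCost_eq_sum_liveEdges k F (Setoid.ker f) f fun _ _ => Iff.rfl,
    sum_liveEdges_normWeight, div_mul_eq_mul_div, le_div_iff₀ (hF.cutWeight_pos hne)]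
  have h1 := hF.cutWeight_le (σ := Setoid.ker f) (by
    rw [Nat.card_congr (Setoid.quotientKerEquivRange f)]
    exact hf)
  have h2 : (G.cutWeight F : ℝ) ≤ G.liveSum (Setoid.ker f) := by
    rw [liveSum, ← cast_cutWeight]
    exact_mod_cast h1
  gcongr

/-- The verification of lower bounds for the success probability, for normalized weights. -/
theorem IsMinKCut.le_outputProb_of_normWeight [Fintype V] (hF : G.IsMinKCut k F)
    (hne : F.Nonempty) (hk : 0 < k) (Φ : Setoid V → ℝ) (hΦ₁ : Φ (G.cutSetoid F) ≤ 1)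
    (hΦ : ∀ r < G.cutSetoid F,
      (∀ j, Nat.card (Quotient r) ≤ j → Φ r ≤ G.outputProb k F j r) ∨
      Φ r * (∑ e ∈ G.liveEdges r \ F, G.normWeight k F e + k) ≤
        ∑ e ∈ G.liveEdges r \ F, G.normWeight k F e * Φ (contract r e))
    (j : ℕ) (r : Setoid V) (hr : r ≤ G.cutSetoid F) (hj : Nat.card (Quotient r) ≤ j) :
    Φ r ≤ G.outputProb k F j r := by
  refine hF.le_outputProb Φ hΦ₁ (fun r hr => (hΦ r hr).imp_right fun h => ?_) j r hr hj
  have hc : 0 < (k : ℝ) / G.cutWeight F :=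
    div_pos (by exact_mod_cast hk) (hF.cutWeight_pos hne)
  rw [← hF.sum_normWeight hne, Finset.sum_sdiff (hF.subset_liveEdges hr.le),
    sum_liveEdges_normWeight] at h
  have h2 : ∑ e ∈ G.liveEdges r \ F, G.normWeight k F e * Φ (contract r e) =
      k / (G.cutWeight F : ℝ) * ∑ e ∈ G.liveEdges r \ F, (G.weight e : ℝ) * Φ (contract r e) := by
    rw [mul_sum]
    refine sum_congr rfl fun e he => ?_
    rw [normWeight, if_pos (mem_edgeSet_of_mem_liveEdges (mem_sdiff.1 he).1), mul_assoc]
  rw [h2] at h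
  refine le_of_mul_le_mul_left (le_trans (le_of_eq ?_) h) hc
  ring

theorem card_contract_of_mem [Fintype V] {r : Setoid V} {e : Sym2 V} (he : e ∈ G.liveEdges r) :
    Nat.card (Quotient (contract r e)) + 1 = Nat.card (Quotient r) := by
  have h := card_contract_add_one r ((G.mem_liveEdges_iff r e).1 he).2
  rwa [mk_src_tgt] at h

theorem IsMinKCut.colorCost_quotient [Fintype V] (hF : G.IsMinKCut k F) (hne : F.Nonempty)
    {r : Setoid V} (hr : r ≤ G.cutSetoid F) :
    colorCost (G.normWeight k F) (Quotient.mk r ∘ src) (Quotient.mk r ∘ tgt) id =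
      ∑ e ∈ G.liveEdges r \ F, G.normWeight k F e + k := by
  rw [← hF.sum_normWeight hne, Finset.sum_sdiff (hF.subset_liveEdges hr)]
  exact G.colorCost_eq_sum_liveEdges k F r (Quotient.mk r) fun _ _ => Quotient.eq

/-- Karger and Stein's bound for the success probability. -/
theorem IsMinKCut.inv_choose_le_outputProb [Fintype V] (hF : G.IsMinKCut k F)
    (hne : F.Nonempty) (hk : 2 ≤ k) (j : ℕ) (r : Setoid V) (hr : r ≤ G.cutSetoid F)
    (hj : Nat.card (Quotient r) ≤ j) :
    (((Nat.card (Quotient r)).choose (k - 1) : ℝ) *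
      ((Nat.card (Quotient r) - 1).choose (k - 1) : ℝ))⁻¹ ≤ G.outputProb k F j r := by
  refine hF.le_outputProb_of_normWeight hne (by omega) (fun r =>
    (((Nat.card (Quotient r)).choose (k - 1) : ℝ) *
      ((Nat.card (Quotient r) - 1).choose (k - 1) : ℝ))⁻¹) ?_ ?_ j r hr hj
  · have h1 := hF.card_eq_of_nonempty hne
    rw [h1]
    refine inv_le_one_of_one_le₀ ?_
    have h2 : 1 ≤ k.choose (k - 1) := Nat.choose_pos (by omega)
    have h3 : 1 ≤ (k - 1).choose (k - 1) := Nat.choose_pos le_rfl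
    exact_mod_cast Nat.mul_le_mul h2 h3
  · intro r hr
    right
    have hkR : k < Nat.card (Quotient r) := lt_of_le_of_lt hF.le_card (card_quotient_lt hr)
    have h1 := ((hF.coloringBound hne).contract (Quotient.mk_surjective (s := r))).mul_choose_le
      (by omega) (by rw [← Nat.card_eq_fintype_card]; exact hkR.le)
    rw [hF.colorCost_quotient hne hr.le, ← Nat.card_eq_fintype_card] at h1
    set R := Nat.card (Quotient r) with hR
    set W := ∑ e ∈ G.liveEdges r \ F, G.normWeight k F e with hW
    have h2 : ∑ e ∈ G.liveEdges r \ F, G.normWeight k F e *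
        (((Nat.card (Quotient (contract r e))).choose (k - 1) : ℝ) *
          ((Nat.card (Quotient (contract r e)) - 1).choose (k - 1) : ℝ))⁻¹ =
        W * (((R - 1).choose (k - 1) : ℝ) * ((R - 2).choose (k - 1) : ℝ))⁻¹ := by
      rw [hW, sum_mul]
      refine sum_congr rfl fun e he => ?_
      have h3 := card_contract_of_mem (mem_sdiff.1 he).1
      have h4 : Nat.card (Quotient (contract r e)) = R - 1 := by omega
      rw [h4]
      congr 4
    rw [h2]
    have c0 : (0 : ℝ) < (R.choose (k - 1) : ℝ) := by exact_mod_cast Nat.choose_pos (by omega)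
    have c1 : (0 : ℝ) < ((R - 1).choose (k - 1) : ℝ) := by
      exact_mod_cast Nat.choose_pos (by omega)
    have c2 : (0 : ℝ) < ((R - 2).choose (k - 1) : ℝ) := by
      exact_mod_cast Nat.choose_pos (by omega)
    -- The factor at `R - 1` is common to both sides; what remains is `mul_choose_le`.
    rw [inv_mul_eq_div, ← div_eq_mul_inv, div_le_div_iff₀ (by positivity) (by positivity)]
    nlinarith

/-! ### Tame cuts and the potential. -/

/-- The small cuts which contain little of the weight of `F`. -/
noncomputable def tameCuts [Fintype V] (G : WeightedGraph V) (k : ℕ) (F : Finset (Sym2 V))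
    (ε : ℝ) : Finset (Finset V) :=
  univ.filter fun S => (1 ≤ cutCost (G.normWeight k F) src tgt S ∧
    cutCost (G.normWeight k F) src tgt S < 2) ∧ cutCost (G.normWeightOn k F) src tgt S ≤ ε

/-- The tame cuts none of whose edges have been contracted. -/
noncomputable def survivors [Fintype V] (G : WeightedGraph V) (k : ℕ) (F : Finset (Sym2 V))
    (ε : ℝ) (r : Setoid V) : Finset (Finset V) :=
  (G.tameCuts k F ε).filter fun S => ∀ u v, r u v → (u ∈ S ↔ v ∈ S)

theorem survivors_contract [Fintype V] (ε : ℝ) (r : Setoid V) (e : Sym2 V) :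
    G.survivors k F ε (contract r e) =
      (G.survivors k F ε r).filter fun S => (src e ∈ S ↔ tgt e ∈ S) := by
  ext S
  simp only [survivors, mem_filter, and_assoc]
  refine and_congr_right fun _ => ?_
  have he := mk_src_tgt e
  constructor
  · intro h
    refine ⟨fun u v huv => h u v (le_contract r e huv), h _ _ ?_⟩
    have := contract_apply_self r (src e) (tgt e)
    rwa [he] at this
  · rintro ⟨h1, h2⟩ u v huv
    rw [← he] at huv
    have h3 : contract r s(src e, tgt e) ≤ Setoid.ker (fun v : V => v ∈ S) :=
      contract_le (fun u v huv => Setoid.ker_def.2 (propext (h1 u v huv)))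
        (Setoid.ker_def.2 (propext h2))
    exact iff_of_eq (h3 huv)

theorem IsMinKCut.sum_normWeightOn [Fintype V] (hF : G.IsMinKCut k F) (hne : F.Nonempty) :
    ∑ e, G.normWeightOn k F e = k := by
  simp only [normWeightOn, Finset.sum_ite_mem, Finset.univ_inter]
  exact hF.sum_normWeight hne

/-- The low-degree vertices left over by `card_le` are, as classes of original vertices, distinct
surviving tame cuts. -/
theorem IsMinKCut.card_quotient_le_add [Fintype V] (hF : G.IsMinKCut k F) (hne : F.Nonempty)
    (hk : 2 ≤ k) {ε : ℝ} (hε : 0 < ε) {r : Setoid V} (hr : r ≤ G.cutSetoid F) :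
    (Nat.card (Quotient r) : ℝ) ≤ ∑ e ∈ G.liveEdges r \ F, G.normWeight k F e + k + k + 2 * k / ε +
      (G.survivors k F ε r).card := by
  have h1 := ((hF.coloringBound hne).contract (Quotient.mk_surjective (s := r))).card_le
    (hF.normWeight_nonneg hne) (hF.normWeightOn_nonneg hne) hk (by
      rw [← Nat.card_eq_fintype_card]
      exact hF.le_card.trans (card_quotient_le hr)) (hF.sum_normWeightOn hne).le hε
  rw [hF.colorCost_quotient hne hr, ← Nat.card_eq_fintype_card] at h1
  refine h1.trans ?_
  gcongr
  refine Finset.card_le_card_of_injOn (fun a => univ.filter fun v => Quotient.mk r v = a) ?_ ?_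
  · intro a ha
    have hcut : ∀ w : Sym2 V → ℝ, cutCost w src tgt (univ.filter fun v => Quotient.mk r v = a) =
        cutCost w (Quotient.mk r ∘ src) (Quotient.mk r ∘ tgt) {a} := fun w => by
      simp only [cutCost_eq, mem_filter, mem_univ, true_and, mem_singleton, Function.comp]
    simp only [mem_coe, survivors, tameCuts, mem_filter, mem_univ, true_and, hcut] at ha ⊢
    refine ⟨ha, fun u v huv => ?_⟩
    rw [Quotient.sound huv]
  · intro a _ b _ hab
    obtain ⟨v, rfl⟩ := Quotient.mk_surjective a
    have : v ∈ univ.filter fun u => Quotient.mk r u = b := by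
      have h2 : (univ.filter fun u => Quotient.mk r u = Quotient.mk r v) =
        univ.filter fun u => Quotient.mk r u = b := hab
      rw [← h2]
      simp
    exact (mem_filter.1 this).2

/-- Double counting: a survivor is destroyed by exactly the contractions of its own edges, all of
which are still live, and those outside `F` weigh at least `1 - ε`. -/
theorem le_sum_survivors_drop [Fintype V] (ε : ℝ) (r : Setoid V) :
    (1 - ε) * (G.survivors k F ε r).card ≤ ∑ e ∈ G.liveEdges r \ F, G.normWeight k F e *
      ((G.survivors k F ε r).card - (G.survivors k F ε (contract r e)).card) := by
  have h1 : ∀ e, (((G.survivors k F ε r).card : ℝ) - (G.survivors k F ε (contract r e)).card) =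
      ∑ S ∈ G.survivors k F ε r, zeroIf (src e ∈ S ↔ tgt e ∈ S) 1 := by
    intro e
    rw [survivors_contract, ← Finset.card_filter_add_card_filter_not
      (s := G.survivors k F ε r) (fun S => (src e ∈ S ↔ tgt e ∈ S))]
    push_cast
    rw [add_sub_cancel_left, Finset.card_filter]
    push_cast
    refine sum_congr rfl fun S _ => ?_
    by_cases h : (src e ∈ S ↔ tgt e ∈ S)
    · rw [zeroIf_pos h, if_neg (not_not.2 h)]
    · rw [zeroIf_neg h, if_pos h]
  simp only [h1, mul_sum]
  rw [sum_comm]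
  calc (1 - ε) * ((G.survivors k F ε r).card : ℝ) = ∑ S ∈ G.survivors k F ε r, (1 - ε) := by
        rw [sum_const, nsmul_eq_mul, mul_comm]
    _ ≤ _ := Finset.sum_le_sum fun S hS => ?_
  rw [survivors, mem_filter, tameCuts, mem_filter] at hS
  obtain ⟨⟨-, ⟨h2, -⟩, h3⟩, h4⟩ := hS
  have h5 : cutCost (G.normWeight k F) src tgt S - cutCost (G.normWeightOn k F) src tgt S =
      ∑ e ∈ G.liveEdges r \ F, G.normWeight k F e * zeroIf (src e ∈ S ↔ tgt e ∈ S) 1 := by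
    rw [cutCost_eq, cutCost_eq, ← Finset.sum_sub_distrib,
      ← Finset.sum_subset (Finset.subset_univ (G.liveEdges r \ F))]
    · refine sum_congr rfl fun e he => ?_
      rw [normWeightOn, if_neg (mem_sdiff.1 he).2]
      by_cases h : (src e ∈ S ↔ tgt e ∈ S) <;> simp [zeroIf, h]
    · intro e _ he
      by_cases heF : e ∈ F
      · rw [normWeightOn, if_pos heF, sub_self]
      · have heL : e ∉ G.liveEdges r := fun h => he (mem_sdiff.2 ⟨h, heF⟩)
        rw [normWeightOn, if_neg heF]
        rw [mem_liveEdges_iff, not_and_or, not_not] at heL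
        rcases heL with heL | heL
        · rw [normWeight, if_neg heL]
          simp [zeroIf]
        · rw [zeroIf_pos (h4 _ _ heL), zeroIf_pos (h4 _ _ heL), sub_self]
  linarith

/-- The number of vertices of the contracted graph, corrected by the surviving tame cuts. -/
noncomputable def potential [Fintype V] (G : WeightedGraph V) (k : ℕ) (F : Finset (Sym2 V))
    (ε : ℝ) (r : Setoid V) : ℝ :=
  (Nat.card (Quotient r) : ℝ) - (2 * k + 2 * k / ε) + (G.survivors k F ε r).card / ε

/-- Write `a = 2k + 2k/ε` and let `A` be the number of survivors. The vertex count contributes `W ≥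
R - a - A` and the survivors contribute at least `(1 - ε)A/ε`. The sum `(R - a) + A/ε - 2A` is at
least `(1 - 2ε)` times the potential because `R ≥ a`. -/
theorem IsMinKCut.potential_drift [Fintype V] (hF : G.IsMinKCut k F) (hne : F.Nonempty)
    (hk : 2 ≤ k) {ε : ℝ} (hε : 0 < ε) {r : Setoid V} (hr : r ≤ G.cutSetoid F)
    (hR : 2 * k + 2 * k / ε ≤ (Nat.card (Quotient r) : ℝ)) :
    (1 - 2 * ε) * G.potential k F ε r ≤ ∑ e ∈ G.liveEdges r \ F, G.normWeight k F e *
      (G.potential k F ε r - G.potential k F ε (contract r e)) := by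
  have h1 : ∀ e ∈ G.liveEdges r \ F, G.normWeight k F e *
      (G.potential k F ε r - G.potential k F ε (contract r e)) = G.normWeight k F e +
        (G.normWeight k F e *
          ((G.survivors k F ε r).card - (G.survivors k F ε (contract r e)).card)) / ε := by
    intro e he
    have h2 := card_contract_of_mem (mem_sdiff.1 he).1
    rw [potential, potential, ← h2]
    push_cast
    ring
  rw [sum_congr rfl h1, sum_add_distrib, ← sum_div]
  have h3 := le_sum_survivors_drop (G := G) (k := k) (F := F) ε r
  have h4 := hF.card_quotient_le_add hne hk hε hr
  have h5 := div_le_div_of_nonneg_right h3 hε.le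
  refine le_trans ?_ (add_le_add_right h5 _)
  rw [potential]
  set A : ℝ := ((G.survivors k F ε r).card : ℝ)
  have h6 : (1 - 2 * ε) * (A / ε) = A / ε - 2 * A := by field_simp
  have h7 : (1 - ε) * A / ε = A / ε - A := by field_simp
  rw [mul_add, h6, h7]
  nlinarith

/-- The convex function `x ^ (-κ)` lies above its tangent at `y`. -/
theorem rpow_neg_tangent {x y κ : ℝ} (hx : 0 < x) (hy : 0 < y) (hκ : 0 ≤ κ) :
    y ^ (-κ) * (1 + κ * ((y - x) / y)) ≤ x ^ (-κ) := by
  have h1 : x ^ (-κ) = y ^ (-κ) * (x / y) ^ (-κ) := by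
    rw [← Real.mul_rpow hy.le (by positivity), mul_div_cancel₀ _ hy.ne']
  rw [h1]
  refine mul_le_mul_of_nonneg_left ?_ (Real.rpow_nonneg hy.le _)
  rw [Real.rpow_def_of_pos (by positivity)]
  have h2 := Real.log_le_sub_one_of_pos (show 0 < x / y by positivity)
  have h3 := Real.add_one_le_exp (Real.log (x / y) * -κ)
  have h4 : (y - x) / y = 1 - x / y := by field_simp
  rw [h4]
  nlinarith

/-- The success probability is at least an inverse power of the potential. -/
theorem IsMinKCut.potential_le_outputProb [Fintype V] (hF : G.IsMinKCut k F) (hne : F.Nonempty)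
    (hk : 2 ≤ k) {ε : ℝ} (hε : 0 < ε) (hε' : ε < 1 / 2) (j : ℕ) (r : Setoid V)
    (hr : r ≤ G.cutSetoid F) (hj : Nat.card (Quotient r) ≤ j) :
    ((2 * k + 2 * k / ε + 2) ^ (2 * k))⁻¹ *
      max (G.potential k F ε r) 1 ^ (-(k / (1 - 2 * ε))) ≤ G.outputProb k F j r := by
  set a : ℝ := 2 * k + 2 * k / ε with ha
  set κ : ℝ := k / (1 - 2 * ε) with hκ
  have ha0 : 0 ≤ a := by positivity
  have hb : 0 < 1 - 2 * ε := by linarith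
  have hκ0 : 0 ≤ κ := by positivity
  have hc0 : (0 : ℝ) < ((a + 2) ^ (2 * k))⁻¹ := by positivity
  have hpow : ∀ r, max (G.potential k F ε r) 1 ^ (-κ) ≤ 1 := fun r =>
    Real.rpow_le_one_of_one_le_of_nonpos (le_max_right _ _) (by linarith)
  have hbase : ∀ r ≤ G.cutSetoid F, (Nat.card (Quotient r) : ℝ) < a + 2 → ∀ j,
      Nat.card (Quotient r) ≤ j → ((a + 2) ^ (2 * k))⁻¹ ≤ G.outputProb k F j r := by
    intro r hr hR j hj
    refine le_trans ?_ (hF.inv_choose_le_outputProb hne hk j r hr hj)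
    have hkR : k ≤ Nat.card (Quotient r) := hF.le_card.trans (card_quotient_le hr)
    set R := Nat.card (Quotient r)
    have c0 : (0 : ℝ) < (R.choose (k - 1) : ℝ) := by exact_mod_cast Nat.choose_pos (by omega)
    have c1 : (0 : ℝ) < ((R - 1).choose (k - 1) : ℝ) := by
      exact_mod_cast Nat.choose_pos (by omega)
    refine inv_anti₀ (by positivity) ?_
    have d0 : (R.choose (k - 1) : ℝ) ≤ (a + 2) ^ (k - 1) := by
      have d : (R.choose (k - 1) : ℝ) ≤ (R : ℝ) ^ (k - 1) := by
        exact_mod_cast Nat.choose_le_pow R (k - 1)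
      exact d.trans (by gcongr)
    have d1 : ((R - 1).choose (k - 1) : ℝ) ≤ (a + 2) ^ (k - 1) := by
      have d : ((R - 1).choose (k - 1) : ℝ) ≤ (R.choose (k - 1) : ℝ) := by
        exact_mod_cast Nat.choose_mono (k - 1) (Nat.sub_le R 1)
      exact d.trans d0
    calc _ ≤ (a + 2) ^ (k - 1) * (a + 2) ^ (k - 1) := by gcongr
      _ = (a + 2) ^ (2 * k - 2) := by rw [← pow_add]; congr 1; omega
      _ ≤ _ := pow_le_pow_right₀ (by linarith) (by omega)
  refine hF.le_outputProb_of_normWeight hne (by omega) (fun r =>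
    ((a + 2) ^ (2 * k))⁻¹ * max (G.potential k F ε r) 1 ^ (-κ)) ?_ ?_ j r hr hj
  · refine mul_le_one₀ (inv_le_one_of_one_le₀ (one_le_pow₀ (by linarith))) ?_ (hpow _)
    positivity
  · intro r hr
    -- From `a + 2` vertices on, the potential is still at least 1 after a contraction, so the
    -- truncation by `max` is inactive. Below that, the Karger–Stein bound loses at most `(a + 2) ^
    -- (2 * k)`.
    rcases lt_or_ge (Nat.card (Quotient r) : ℝ) (a + 2) with hR | hR
    · exact Or.inl fun j hj => (mul_le_of_le_one_right hc0.le (hpow r)).trans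
        (hbase r hr.le hR j hj)
    · right
      have hP : ∀ r : Setoid V, (Nat.card (Quotient r) : ℝ) - a ≤ G.potential k F ε r := by
        intro r
        rw [potential]
        have : 0 ≤ ((G.survivors k F ε r).card : ℝ) / ε := by positivity
        linarith
      have hdrift := hF.potential_drift hne hk hε hr.le (by linarith)
      set Ψ := G.potential k F ε r with hΨ
      have hΨ2 : 2 ≤ Ψ := by linarith [hP r]
      have hstep : ∀ e ∈ G.liveEdges r \ F, 1 ≤ G.potential k F ε (contract r e) := by
        intro e he
        have h2 := card_contract_of_mem (mem_sdiff.1 he).1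
        have h3 : (Nat.card (Quotient (contract r e)) : ℝ) + 1 = Nat.card (Quotient r) := by
          exact_mod_cast h2
        linarith [hP (contract r e)]
      rw [max_eq_left (by linarith : 1 ≤ Ψ)]
      set W := ∑ e ∈ G.liveEdges r \ F, G.normWeight k F e with hW
      calc ((a + 2) ^ (2 * k))⁻¹ * Ψ ^ (-κ) * (W + k)
          ≤ ((a + 2) ^ (2 * k))⁻¹ * Ψ ^ (-κ) *
              (W + κ / Ψ * ∑ e ∈ G.liveEdges r \ F, G.normWeight k F e *
                (Ψ - G.potential k F ε (contract r e))) := by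
            gcongr
            calc (k : ℝ) = κ / Ψ * ((1 - 2 * ε) * Ψ) := by
                  rw [hκ]
                  field_simp
              _ ≤ _ := by gcongr
        _ = ∑ e ∈ G.liveEdges r \ F, G.normWeight k F e * (((a + 2) ^ (2 * k))⁻¹ *
              (Ψ ^ (-κ) * (1 + κ * ((Ψ - G.potential k F ε (contract r e)) / Ψ)))) := by
            rw [hW, mul_sum, ← sum_add_distrib, mul_sum]
            refine sum_congr rfl fun e _ => ?_
            ring
        _ ≤ _ := by
            refine Finset.sum_le_sum fun e he => ?_
            have h1 := hstep e he
            refine mul_le_mul_of_nonneg_left ?_ (hF.normWeight_nonneg hne e)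
            refine mul_le_mul_of_nonneg_left ?_ hc0.le
            simp only [max_eq_left h1]
            exact rpow_neg_tangent (by linarith) (by linarith) hκ0

end

end WeightedGraph

/-! ### Estimates of the loss. -/

open Real in
theorem one_lt_log_three : 1 < log 3 := by
  rw [lt_log_iff_exp_lt (by norm_num)]
  exact exp_one_lt_d9.trans (by norm_num)

open Real in
/-- Comparison of the loss in the potential argument with the loss that is allowed. -/
theorem loss_le {k : ℕ} (hk : 2 ≤ k) {l : ℝ} (hl : log 3 ≤ l) :
    2 * k * log (2 * k + 2 * k / (1 / (4 * l)) + 2) +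
      k / (1 - 2 * (1 / (4 * l))) *
        (l + log (33 * l * ((k * (3 * k) + 1 : ℝ) ^ (3 * k)))) ≤
      k * l + 40 / log (log 3) * k ^ 2 * log l * log (k * l) := by
  have hl1 : 1 < l := one_lt_log_three.trans_le hl
  have hk2 : (2 : ℝ) ≤ k := by exact_mod_cast hk
  have hX : log (k * l) = log k + log l := log_mul (by positivity) (by positivity)
  have hlogk : log 2 ≤ log k := log_le_log (by norm_num) hk2
  have hlogl : 0 < log l := log_pos hl1
  have hln2 : 0.69 < log 2 := by linarith [log_two_gt_d9]
  have hln2' : log 2 < 0.7 := by linarith [log_two_lt_d9]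
  have hlog4 : log 4 = 2 * log 2 := by
    rw [show (4 : ℝ) = 2 ^ 2 by norm_num, log_pow]; norm_num
  have hlog64 : log 64 = 6 * log 2 := by
    rw [show (64 : ℝ) = 2 ^ 6 by norm_num, log_pow]; norm_num
  have hlog16 : log 16 = 4 * log 2 := by
    rw [show (16 : ℝ) = 2 ^ 4 by norm_num, log_pow]; norm_num
  set X := log (k * l) with hXdef
  have ha : log (2 * k + 2 * k / (1 / (4 * l)) + 2) ≤ 5 * X := by
    have h1 : (2 * k + 2 * k / (1 / (4 * l)) + 2 : ℝ) ≤ 16 * (k * l) := by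
      have : (2 * k / (1 / (4 * l)) : ℝ) = 8 * (k * l) := by field_simp; ring
      rw [this]
      nlinarith
    refine (log_le_log (by positivity) h1).trans ?_
    rw [log_mul (by norm_num) (by positivity), hlog16]
    linarith
  have hB : log (33 * l * ((k * (3 * k) + 1 : ℝ) ^ (3 * k))) ≤ 16 * k * X := by
    rw [log_mul (by positivity) (by positivity), log_mul (by norm_num) (by positivity), log_pow]
    have h1 : log 33 ≤ 6 * log 2 := hlog64 ▸ log_le_log (by norm_num) (by norm_num)
    have h2 : log (k * (3 * k) + 1 : ℝ) ≤ 4 * X := by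
      have h3 : (k * (3 * k) + 1 : ℝ) ≤ 4 * k ^ 2 := by nlinarith
      refine (log_le_log (by positivity) h3).trans ?_
      rw [log_mul (by norm_num) (by positivity), log_pow, hlog4]
      push_cast
      linarith
    push_cast
    have h3 : 3 * (k : ℝ) * log (k * (3 * k) + 1 : ℝ) ≤ 3 * k * (4 * X) := by gcongr
    nlinarith
  have hden : 1 - 2 * (1 / (4 * l)) = (2 * l - 1) / (2 * l) := by field_simp; ring
  have hκ : k / (1 - 2 * (1 / (4 * l))) = 2 * k * l / (2 * l - 1) := by
    rw [hden, div_div_eq_mul_div]; ring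
  have h2l : 0 < 2 * l - 1 := by linarith
  have hκl : k / (1 - 2 * (1 / (4 * l))) * l ≤ k * l + k := by
    rw [hκ, div_mul_eq_mul_div, div_le_iff₀ h2l]
    nlinarith
  have hκ2 : k / (1 - 2 * (1 / (4 * l))) ≤ 2 * k := by
    rw [hκ, div_le_iff₀ h2l]
    nlinarith
  have hκ0 : 0 ≤ k / (1 - 2 * (1 / (4 * l))) := by rw [hκ]; positivity
  have hX0 : 0.69 < X := by linarith
  have hL : 0 < log (log 3) := log_pos one_lt_log_three
  -- Losses without a factor `log l` are absorbed because `log l` is at least the positive constant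
  -- `log (log 3)`. This is the source of the denominator in the constant.
  have hmain : 40 * k ^ 2 * X ≤ 40 / log (log 3) * k ^ 2 * log l * X := by
    have h1 : log (log 3) ≤ log l := log_le_log (by linarith [one_lt_log_three]) hl
    have h2 : 1 ≤ log l / log (log 3) := (one_le_div hL).2 h1
    calc 40 * (k : ℝ) ^ 2 * X = 40 * k ^ 2 * X * 1 := by ring
      _ ≤ 40 * k ^ 2 * X * (log l / log (log 3)) := by gcongr
      _ = _ := by ring
  have hBκ : k / (1 - 2 * (1 / (4 * l))) *
      log (33 * l * ((k * (3 * k) + 1 : ℝ) ^ (3 * k))) ≤ 2 * k * (16 * k * X) :=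
    (mul_le_mul_of_nonneg_left hB hκ0).trans (mul_le_mul_of_nonneg_right hκ2 (by positivity))
  have haκ : 2 * k * log (2 * k + 2 * k / (1 / (4 * l)) + 2) ≤ 2 * k * (5 * X) := by gcongr
  have hkX : (k : ℝ) * X * 2 ≤ k * X * k := by gcongr
  have hk1 : (k : ℝ) ≤ 2 * (k * X) := by nlinarith
  rw [mul_add]
  nlinarith

/-! ### Conclusion. -/

namespace WeightedGraph

open Finset Multigraph Real

theorem IsMinKCut.le_card_vertices {V : Type u} [Fintype V] {G : WeightedGraph V} {k : ℕ}
    {F : Finset (Sym2 V)} (hF : G.IsMinKCut k F) : k ≤ Fintype.card V := by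
  rw [← Nat.card_eq_fintype_card]
  exact hF.le_card.trans (Nat.card_le_card_of_surjective _ Quotient.mk_surjective)

/-- No sampled edge can be fatal here, so the constant 1 is preserved by every step. -/
theorem IsMinKCut.kargerStein_of_empty {V : Type u} [Fintype V] {G : WeightedGraph V} {k : ℕ}
    (hF : G.IsMinKCut k ∅) : 1 ≤ (G.kargerStein k ∅).toReal := by
  classical
  rw [← outputProb_card_bot]
  refine hF.le_outputProb (fun _ => 1) le_rfl (fun r _ => Or.inr ?_) _ ⊥ bot_le ?_
  · simp [liveSum]
  · rw [← Nat.card_eq_fintype_card]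
    exact Nat.card_le_card_of_surjective _ Quotient.mk_surjective

/-- The linear bound on small cuts enters here. The constant is `33 = 1 + 4 * 8`: one for the
vertices, and `8` from `card_smallCuts_le` times the `4` in `1/ε = 4l`. -/
theorem IsMinKCut.potential_bot_le {V : Type u} [Fintype V] {G : WeightedGraph V} {k : ℕ}
    {F : Finset (Sym2 V)} (hF : G.IsMinKCut k F) (hne : F.Nonempty) (hk : 2 ≤ k) {l : ℝ}
    (hl : 1 ≤ l) :
    G.potential k F (1 / (4 * l)) ⊥ ≤
      Fintype.card V * (33 * l * ((k * (3 * k) + 1 : ℝ) ^ (3 * k))) := by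
  classical
  have h1 : Nat.card (Quotient (⊥ : Setoid V)) ≤ Fintype.card V := by
    rw [← Nat.card_eq_fintype_card]
    exact Nat.card_le_card_of_surjective _ Quotient.mk_surjective
  have h2 : (G.survivors k F (1 / (4 * l)) ⊥).card ≤
      8 * (k * (3 * k) + 1) ^ (3 * k) * Fintype.card V := by
    refine le_trans (Finset.card_le_card fun S hS => ?_) (card_smallCuts_le
      (hF.normWeight_nonneg hne) hk (hF.coloringBound hne) hF.le_card_vertices)
    rw [survivors, mem_filter, tameCuts, mem_filter] at hS
    exact mem_smallCuts.2 hS.1.2.1.2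
  have h3 : ((G.survivors k F (1 / (4 * l)) ⊥).card : ℝ) ≤
      8 * (k * (3 * k) + 1 : ℝ) ^ (3 * k) * Fintype.card V := by exact_mod_cast h2
  have h4 : (Nat.card (Quotient (⊥ : Setoid V)) : ℝ) ≤ Fintype.card V := by exact_mod_cast h1
  have h5 : 1 ≤ (k * (3 * k) + 1 : ℝ) ^ (3 * k) :=
    one_le_pow₀ (le_add_of_nonneg_left (by positivity))
  have h6 : ((G.survivors k F (1 / (4 * l)) ⊥).card : ℝ) / (1 / (4 * l)) =
      4 * l * (G.survivors k F (1 / (4 * l)) ⊥).card := by field_simp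
  rw [potential, h6]
  have h7 : (0 : ℝ) ≤ 2 * k + 2 * k / (1 / (4 * l)) := by positivity
  have h8 := mul_le_mul_of_nonneg_left h3 (show 0 ≤ 4 * l by positivity)
  have h9 : (Fintype.card V : ℝ) * 1 ≤
      Fintype.card V * (l * ((k * (3 * k) + 1 : ℝ) ^ (3 * k))) :=
    mul_le_mul_of_nonneg_left (one_le_mul_of_one_le_of_one_le hl h5) (by positivity)
  nlinarith

theorem IsMinKCut.le_kargerStein {V : Type u} [Fintype V] {G : WeightedGraph V} {k : ℕ}
    {F : Finset (Sym2 V)} (hF : G.IsMinKCut k F) (hk : 2 ≤ k) (hV : 3 ≤ Fintype.card V) :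
    ((Fintype.card V : ℝ) ^ k)⁻¹ * ((k : ℝ) * log (Fintype.card V)) ^
        (-(40 / log (log 3) * (k : ℝ) ^ 2 * log (log (Fintype.card V)))) ≤
      (G.kargerStein k F).toReal := by
  have hn : (3 : ℝ) ≤ Fintype.card V := by exact_mod_cast hV
  have hk2 : (2 : ℝ) ≤ k := by exact_mod_cast hk
  set n : ℝ := (Fintype.card V : ℝ) with hndef
  set l := log n with hldef
  have hl : log 3 ≤ l := log_le_log (by norm_num) hn
  have hl1 : 1 < l := one_lt_log_three.trans_le hl
  have hkl : 1 < k * l := by nlinarith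
  rcases F.eq_empty_or_nonempty with rfl | hne
  · refine le_trans ?_ hF.kargerStein_of_empty
    refine mul_le_one₀ (inv_le_one_of_one_le₀ (one_le_pow₀ (by linarith))) (by positivity) ?_
    refine rpow_le_one_of_one_le_of_nonpos hkl.le ?_
    have h1 := log_pos hl1
    have h2 := log_pos one_lt_log_three
    have : 0 ≤ 40 / log (log 3) * (k : ℝ) ^ 2 * log l := by positivity
    linarith
  -- The choice of `ε` of order `1 / log n` keeps `n ^ (-κ)` within a factor `e ^ (-k)` of `n ^
  -- (-k)`, while `1/ε` only enters with a logarithmic size.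
  · have hε' : 1 / (4 * l) < 1 / 2 := by
      rw [div_lt_div_iff₀ (by positivity) (by norm_num)]; linarith
    have h1 := hF.potential_le_outputProb hne hk (ε := 1 / (4 * l)) (by positivity) hε'
      (Fintype.card V) ⊥ bot_le (by
        rw [← Nat.card_eq_fintype_card]
        exact Nat.card_le_card_of_surjective _ Quotient.mk_surjective)
    rw [outputProb_card_bot] at h1
    refine le_trans ?_ h1
    have h2 := hF.potential_bot_le hne hk hl1.le
    rw [← hndef] at h2
    set B : ℝ := 33 * l * ((k * (3 * k) + 1 : ℝ) ^ (3 * k)) with hB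
    set κ : ℝ := k / (1 - 2 * (1 / (4 * l))) with hκ
    have hB1 : 1 ≤ B := by
      have h5 : 1 ≤ (k * (3 * k) + 1 : ℝ) ^ (3 * k) :=
        one_le_pow₀ (le_add_of_nonneg_left (by positivity))
      exact one_le_mul_of_one_le_of_one_le (by linarith) h5
    have hκ0 : 0 ≤ κ := div_nonneg (by positivity) (by linarith)
    have h3 : (n * B) ^ (-κ) ≤ max (G.potential k F (1 / (4 * l)) ⊥) 1 ^ (-κ) :=
      rpow_le_rpow_of_nonpos (lt_max_of_lt_right one_pos)
        (max_le h2 (one_le_mul_of_one_le_of_one_le (by linarith) hB1)) (by linarith)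
    refine le_trans ?_ (mul_le_mul_of_nonneg_left h3 (by positivity))
    have hA : (0 : ℝ) < 2 * k + 2 * k / (1 / (4 * l)) + 2 := by positivity
    rw [← rpow_natCast n k, ← rpow_natCast (_ + 2) (2 * k), ← rpow_neg (by positivity), ← rpow_neg hA.le,
      rpow_def_of_pos (by linarith), rpow_def_of_pos (by linarith), rpow_def_of_pos hA,
      rpow_def_of_pos (by positivity), ← Real.exp_add, ← Real.exp_add, Real.exp_le_exp,
      log_mul (show n ≠ 0 by positivity) (show B ≠ 0 by positivity)]
    have h4 := loss_le hk hl
    rw [← hB, ← hκ] at h4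
    push_cast
    linarith

end WeightedGraph

theorem theorem1 :
    (∃ C : ℝ, 0 < C ∧
      ∀ (V : Type u) [Fintype V] (G : WeightedGraph V) (k : ℕ) (F : Finset (Sym2 V)),
        2 ≤ k → 3 ≤ Fintype.card V → G.IsMinKCut k F →
          ((Fintype.card V : ℝ) ^ k)⁻¹ *
              ((k : ℝ) * Real.log (Fintype.card V)) ^
                (-(C * (k : ℝ) ^ 2 * Real.log (Real.log (Fintype.card V)))) ≤
            (G.kargerStein k F).toReal) ∧
    (∀ k : ℕ, 2 ≤ k → ∃ C : ℝ, 0 < C ∧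
      ∀ (V : Type u) [Fintype V] (G : WeightedGraph V) (F : Finset (Sym2 V)),
        3 ≤ Fintype.card V → G.IsMinKCut k F →
          ((Fintype.card V : ℝ) ^ k)⁻¹ *
              (2 : ℝ) ^ (-(C * Real.log (Real.log (Fintype.card V)) ^ 2)) ≤
            (G.kargerStein k F).toReal) := by
  have hL : 0 < Real.log (Real.log 3) := Real.log_pos one_lt_log_three
  refine ⟨⟨40 / Real.log (Real.log 3), by positivity, ?_⟩, ?_⟩
  · intro V _ G k F hk hV hF
    exact hF.le_kargerStein hk hV
  · intro k hk
    have hk2 : (2 : ℝ) ≤ k := by exact_mod_cast hk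
    have hlogk : 0 < Real.log k := Real.log_pos (by linarith)
    have hln2 : 0 < Real.log 2 := Real.log_pos (by norm_num)
    -- For fixed `k`, `log k` is at most a constant multiple of `log (log n)`, so the exponent
    -- becomes quadratic in `log (log n)`; the division by `log 2` changes the base to 2.
    refine ⟨40 / Real.log (Real.log 3) * (k : ℝ) ^ 2 *
      (Real.log k / Real.log (Real.log 3) + 1) / Real.log 2, by positivity, ?_⟩
    intro V _ G F hV hF
    refine le_trans ?_ (hF.le_kargerStein hk hV)
    have hn : (3 : ℝ) ≤ Fintype.card V := by exact_mod_cast hV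
    set l := Real.log (Fintype.card V : ℝ)
    have hl : Real.log 3 ≤ l := Real.log_le_log (by norm_num) hn
    have hl1 : 1 < l := one_lt_log_three.trans_le hl
    have hL' : Real.log (Real.log 3) ≤ Real.log l :=
      Real.log_le_log (by linarith [one_lt_log_three]) hl
    set L₀ := Real.log (Real.log 3)
    set L := Real.log l
    refine mul_le_mul_of_nonneg_left ?_ (by positivity)
    rw [Real.rpow_def_of_pos (by norm_num), Real.rpow_def_of_pos (by positivity), Real.exp_le_exp,
      Real.log_mul (by positivity) (by positivity)]
    have h1 : Real.log k ≤ Real.log k / L₀ * L := by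
      rw [div_mul_eq_mul_div, le_div_iff₀ hL]
      gcongr
    have h2 : Real.log 2 * -(40 / L₀ * (k : ℝ) ^ 2 * (Real.log k / L₀ + 1) / Real.log 2 * L ^ 2) =
        -((Real.log k / L₀ * L + L) * (40 / L₀ * (k : ℝ) ^ 2 * L)) := by
      field_simp
    have h0 : 0 < L := hL.trans_le hL'
    have h3 : (Real.log k + L) * (40 / L₀ * (k : ℝ) ^ 2 * L) ≤
        (Real.log k / L₀ * L + L) * (40 / L₀ * (k : ℝ) ^ 2 * L) := by gcongr
    rw [h2]
    change _ ≤ (Real.log k + L) * _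
    linarith
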